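/- Let $d\ge 1$ and let $\operatorname{vol}_p$ denote $p$-dimensional Hausdorff measure on $\mathbb R^d$, normalised to agree with Lebesgue measure. For $x\ne 0$ let $P_x$ be the orthogonal projection of $\mathbb R^d$ onto $x^\perp$. For a convex body $K\subset\mathbb R^d$ (convex, compact, non-empty interior) with $0\in K$, a point $x\notin K$ and $z\in P_x(K)$, let $\pi_K(x,z)$ be the minimiser of $\langle y,x\rangle$ over $y\in K\cap\{z+tx:t\in\mathbb R\}$, and define $$\Psi_K(x,z)=\frac{\operatorname{vol}_1(K\cap[x,\pi_K(x,z)])}{\operatorname{vol}_1([x,\pi_K(x,z)])},\qquad \Psi_K(x)=\frac1{\operatorname{vol}_{d-1}(P_x(K))}\int_{P_x(K)}\Psi_K(x,z)\,d\operatorname{vol}_{d-1}(z).$$ **Lemma.** Let $\mathcal D\subset\mathbb R^d$ be a convex body, let $f,g:\mathcal D\to\mathbb R$ be convex with $f_\star\le g_\star$, where $f_\star=\inf_{\mathcal D}f$ and $g_\star=\inf_{\mathcal D}g$, let $\varepsilon>0$, and let $K=\{x\in\mathcal D: g(x)\le g_\star+\varepsilon\}$. Let $\rho=\operatorname{vol}_{d-1}|_{\partial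 K}/\operatorname{vol}_{d-1}(\partial K)$ be the uniform probability measure on $\partial K$. Assume that $K$ is closed and that $g$ and $(f-g)^2$ are $\rho$-integrable (all of this is automatic when $f$ and $g$ are continuous on $\mathcal D$). Let $x_\star\in\mathcal D$ be a minimiser of $f$, and assume that $0\in K$ and $\Psi_K(x_\star)\in\left[\frac1{128d},\frac1{32d}\right]$. Then $$\int_{\partial K} g\,d\rho-f_\star\le 2^{13}\,d\,\sqrt{\max_{\theta\in S^{d-1}}\left(\frac{\operatorname{vol}_{d-1}(\partial K)}{\operatorname{vol}_{d-1}(P_\theta(K))}\right)\int_{\partial K}(f-g)^2\,d\rho}\,.$$ -/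

import Mathlib

open MeasureTheory

namespace ConvexBandit

/-- A convex body in `ℝᵈ`: a convex compact set with non-empty interior. -/
structure IsConvexBody {d : ℕ} (D : Set (EuclideanSpace ℝ (Fin d))) : Prop where
  convex : Convex ℝ D
  isCompact : IsCompact D
  interior_nonempty : (interior D).Nonempty

/-- The infimum `f_⋆` of `f` over `D`. -/
noncomputable def infOn {d : ℕ} (D : Set (EuclideanSpace ℝ (Fin d)))
    (f : EuclideanSpace ℝ (Fin d) → ℝ) : ℝ :=
  sInf (f '' D)

/-- The level set `{x ∈ D : g x ≤ g_⋆ + ε}`. -/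
def levelSet {d : ℕ} (D : Set (EuclideanSpace ℝ (Fin d)))
    (g : EuclideanSpace ℝ (Fin d) → ℝ) (ε : ℝ) : Set (EuclideanSpace ℝ (Fin d)) :=
  {x | x ∈ D ∧ g x ≤ infOn D g + ε}

/-- The shadow `P_x(K)`: the image of `K` under the orthogonal projection onto the
hyperplane `x^⊥` (as a subset of the ambient space). -/
noncomputable def shadow {d : ℕ} (x : EuclideanSpace ℝ (Fin d))
    (K : Set (EuclideanSpace ℝ (Fin d))) : Set (EuclideanSpace ℝ (Fin d)) :=
  (fun y => (Submodule.span ℝ {x})ᗮ.starProjection y) '' K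

/-- `π_K(x, z)`: the minimiser of `y ↦ ⟪y, x⟫` over the part of `K` on the line
`{z + t x : t ∈ ℝ}`. For `K` compact, `x ≠ 0` and `z` in the shadow of `K` in direction `x`
it exists and is unique. -/
noncomputable def farPoint {d : ℕ} (K : Set (EuclideanSpace ℝ (Fin d)))
    (x z : EuclideanSpace ℝ (Fin d)) : EuclideanSpace ℝ (Fin d) :=
  Classical.epsilon fun y =>
    y ∈ K ∩ Set.range (fun t : ℝ => z + t • x) ∧
      IsMinOn (fun w => inner ℝ w x) (K ∩ Set.range (fun t : ℝ => z + t • x)) y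

/-- The depth/distance ratio `Ψ_K(x, z)`. -/
noncomputable def depthRatio {d : ℕ} (K : Set (EuclideanSpace ℝ (Fin d)))
    (x z : EuclideanSpace ℝ (Fin d)) : ℝ :=
  (μHE[1] : Measure (EuclideanSpace ℝ (Fin d))).real (K ∩ segment ℝ x (farPoint K x z)) /
    (μHE[1] : Measure (EuclideanSpace ℝ (Fin d))).real (segment ℝ x (farPoint K x z))

/-- The average depth/distance ratio `Ψ_K(x)`. -/
noncomputable def avgDepthRatio {d : ℕ} (K : Set (EuclideanSpace ℝ (Fin d)))
    (x : EuclideanSpace ℝ (Fin d)) : ℝ :=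
  ((μHE[d - 1] : Measure (EuclideanSpace ℝ (Fin d))).real (shadow x K))⁻¹ *
    ∫ z in shadow x K, depthRatio K x z ∂(μHE[d - 1] : Measure (EuclideanSpace ℝ (Fin d)))

/-- The surface area probability measure on `∂K`. -/
noncomputable def surfaceProb {d : ℕ} (K : Set (EuclideanSpace ℝ (Fin d))) :
    Measure (EuclideanSpace ℝ (Fin d)) :=
  ((μHE[d - 1] : Measure (EuclideanSpace ℝ (Fin d))) (frontier K))⁻¹ •
    (μHE[d - 1] : Measure (EuclideanSpace ℝ (Fin d))).restrict (frontier K)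

/-- `max_{θ ∈ S^{d-1}} vol_{d-1}(∂K) / vol_{d-1}(P_θ(K))`, written as a supremum. -/
noncomputable def maxSurfaceShadowRatio {d : ℕ} (K : Set (EuclideanSpace ℝ (Fin d))) : ℝ :=
  ⨆ θ : Metric.sphere (0 : EuclideanSpace ℝ (Fin d)) 1,
    (μHE[d - 1] : Measure (EuclideanSpace ℝ (Fin d))).real (frontier K) /
      (μHE[d - 1] : Measure (EuclideanSpace ℝ (Fin d))).real
        (shadow (θ : EuclideanSpace ℝ (Fin d)) K)

end ConvexBandit

/-!
Put `G = g_⋆ + ε`. On a line parallel to `x_⋆` that meets `K`, let `p` be the point of `K` farthest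
from `x_⋆`, let `s` be the depth/distance ratio of the line, and let `q` be the point a fraction `s`
of the way along the segment from `p` to `x_⋆`, where this segment leaves `K`. Then `g q ≥ G`, while
`g p ≤ G`, so convexity of `f` along the segment gives `s * (G - f_⋆) ≤ |f q - g q| + |f p - g p|`.

This is squared and integrated over the lines with `m / 4 ≤ s ≤ 1 / (2d)`, where `m` is the mean
ratio. The ratio `s` is a concave function on the shadow because even `1 / (1 - s)` is one, so by
Brunn–Minkowski the measure `λ(t)` of the lines with `s ≥ t` satisfies `λ(2t) λ(0) ≤ λ(t)²`, and
the bound on `m` forces the lines integrated over to fill at least a sixteenth of the shadow. The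
passage from the shadow to `∂K` costs nothing for `p`, because an orthogonal projection is
1-Lipschitz. For `q`, which lies over the multiple by `1 - s` of the shadow point of its line, it
costs a factor at most `(1 - 1/(2d))^(-d) ≤ 2`.
-/

namespace ConvexBandit

open Set Filter
open scoped ENNReal

section PrekopaLeindler

theorem volume_add_volume_le_of_midpoint_mem_of_isCompact {A B C : Set ℝ} (hA : IsCompact A)
    (hB : IsCompact B) (hA₀ : A.Nonempty) (hB₀ : B.Nonempty)
    (h : ∀ a ∈ A, ∀ b ∈ B, midpoint ℝ a b ∈ C) : volume A + volume B ≤ 2 * volume C := by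
  obtain ⟨a, haA, ha⟩ := hA.exists_isGreatest hA₀
  obtain ⟨b, hbB, hb⟩ := hB.exists_isLeast hB₀
  have volume_half (c : ℝ) (S : Set ℝ) :
      volume S = 2 * volume (AffineMap.homothety c (2⁻¹ : ℝ) '' S) := by
    rw [Measure.addHaar_image_homothety, ← mul_assoc, Module.finrank_self, pow_one,
      abs_of_pos (by norm_num), ENNReal.ofReal_inv_of_pos (by norm_num), ENNReal.ofReal_ofNat,
      ENNReal.mul_inv_cancel (by norm_num) (by norm_num), one_mul]
  -- The halved copies `(A + b) / 2` and `(a + B) / 2` lie in `C` and meet only at `(a + b) / 2`.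
  have hdisj : AEDisjoint volume (AffineMap.homothety b (2⁻¹ : ℝ) '' A)
      (AffineMap.homothety a (2⁻¹ : ℝ) '' B) := by
    refine measure_mono_null ?_ (measure_singleton (midpoint ℝ a b))
    rintro _ ⟨⟨s, hs, rfl⟩, t, ht, hst⟩
    have := ha hs
    have := hb ht
    simp only [homothety_inv_two, midpoint_eq_smul_add, smul_eq_mul,
      mem_singleton_iff, invOf_eq_inv] at hst ⊢
    linarith
  have hmeas : MeasurableSet (AffineMap.homothety a (2⁻¹ : ℝ) '' B) :=
    (hB.image (by fun_prop)).measurableSet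
  rw [volume_half b A, volume_half a B, ← mul_add,
    ← measure_union₀ hmeas.nullMeasurableSet hdisj]
  gcongr
  rintro _ (⟨s, hs, rfl⟩ | ⟨t, ht, rfl⟩)
  · rw [homothety_inv_two, midpoint_comm]
    exact h s hs b hbB
  · rw [homothety_inv_two]
    exact h a haA t ht

theorem volume_add_volume_le_of_midpoint_mem {A B C : Set ℝ} (hA : MeasurableSet A)
    (hB : MeasurableSet B) (hA₀ : A.Nonempty) (hB₀ : B.Nonempty)
    (h : ∀ a ∈ A, ∀ b ∈ B, midpoint ℝ a b ∈ C) : volume A + volume B ≤ 2 * volume C := by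
  obtain ⟨a, ha⟩ := hA₀
  obtain ⟨b, hb⟩ := hB₀
  rw [hA.measure_eq_iSup_isCompact, hB.measure_eq_iSup_isCompact]
  simp_rw [iSup_and']
  refine ENNReal.biSup_add_biSup_le' ⟨∅, empty_subset _, isCompact_empty⟩
    ⟨∅, empty_subset _, isCompact_empty⟩ fun A' hA' B' hB' => ?_
  calc volume A' + volume B' ≤ volume (insert a A') + volume (insert b B') := by
        gcongr <;> exact subset_insert _ _
    _ ≤ 2 * volume C :=
        volume_add_volume_le_of_midpoint_mem_of_isCompact (hA'.2.insert a) (hB'.2.insert b)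
          (insert_nonempty _ _) (insert_nonempty _ _) fun s hs t ht =>
            h s (insert_subset ha hA'.1 hs) t (insert_subset hb hB'.1 ht)

theorem lintegral_eq_lintegral_measure_ofReal_lt {α : Type*} [MeasurableSpace α] (μ : Measure α)
    {f : α → ℝ≥0∞} (hf : Measurable f) (hfin : ∀ a, f a ≠ ∞) :
    ∫⁻ a, f a ∂μ = ∫⁻ t in Ioi (0 : ℝ), μ {a | ENNReal.ofReal t < f a} := by
  have hlayer := lintegral_eq_lintegral_meas_lt μ (f := fun a => (f a).toReal)
    (.of_forall fun _ => ENNReal.toReal_nonneg) hf.ennreal_toReal.aemeasurable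
  simp only [ENNReal.ofReal_toReal (hfin _)] at hlayer
  rw [hlayer]
  refine setLIntegral_congr_fun measurableSet_Ioi fun t ht => ?_
  simp only [ENNReal.ofReal_lt_iff_lt_toReal (le_of_lt ht) (hfin _)]

theorem lintegral_add_lintegral_le_of_iSup_eq_one {f g h : ℝ → ℝ≥0∞} (hf : Measurable f)
    (hg : Measurable g) (hh : Measurable h) (hf₁ : ⨆ x, f x = 1) (hg₁ : ⨆ x, g x = 1)
    (H : ∀ x y, min (f x) (g y) ≤ h (midpoint ℝ x y)) :
    (∫⁻ x, f x) + ∫⁻ x, g x ≤ 2 * ∫⁻ x, h x := by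
  set k : ℝ → ℝ≥0∞ := fun x => min (h x) 1
  have hk : Measurable k := hh.min measurable_const
  have hf_le (x) : f x ≤ 1 := hf₁ ▸ le_iSup f x
  have hg_le (x) : g x ≤ 1 := hg₁ ▸ le_iSup g x
  have ne_top {u : ℝ → ℝ≥0∞} (hu : ∀ x, u x ≤ 1) (x) : u x ≠ ∞ :=
    ((hu x).trans_lt ENNReal.one_lt_top).ne
  have superlevel_antitone (u : ℝ → ℝ≥0∞) :
      Antitone fun t : ℝ => volume {x | ENNReal.ofReal t < u x} := fun s t hst =>
    measure_mono fun x hx => (ENNReal.ofReal_le_ofReal hst).trans_lt hx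
  have superlevel (t : ℝ) : volume {x | ENNReal.ofReal t < f x} +
      volume {x | ENNReal.ofReal t < g x} ≤ 2 * volume {x | ENNReal.ofReal t < k x} := by
    rcases lt_or_ge (ENNReal.ofReal t) 1 with ht | ht
    · exact volume_add_volume_le_of_midpoint_mem (measurableSet_lt measurable_const hf)
        (measurableSet_lt measurable_const hg) (lt_iSup_iff.mp (ht.trans_eq hf₁.symm))
        (lt_iSup_iff.mp (ht.trans_eq hg₁.symm))
        fun x hx y hy => lt_min ((lt_min hx hy).trans_le (H x y)) ht
    · have empty {u : ℝ → ℝ≥0∞} (hu : ∀ x, u x ≤ 1) : {x | ENNReal.ofReal t < u x} = ∅ :=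
        eq_empty_of_forall_notMem fun x hx => ((hx.trans_le (hu x)).trans_le ht).false
      simp [empty hf_le, empty hg_le]
  calc (∫⁻ x, f x) + ∫⁻ x, g x ≤ 2 * ∫⁻ x, k x := by
        rw [lintegral_eq_lintegral_measure_ofReal_lt _ hf (ne_top hf_le),
          lintegral_eq_lintegral_measure_ofReal_lt _ hg (ne_top hg_le),
          lintegral_eq_lintegral_measure_ofReal_lt _ hk (ne_top fun _ => min_le_right _ _),
          ← lintegral_const_mul' _ _ (by norm_num),
          ← lintegral_add_left (superlevel_antitone f).measurable]
        exact lintegral_mono superlevel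
    _ ≤ 2 * ∫⁻ x, h x := by gcongr; exact min_le_left _ _

theorem mul_le_sq_of_add_le_two_mul {a b c : ℝ≥0∞} (h : a + b ≤ 2 * c) : a * b ≤ c ^ 2 := by
  rcases eq_or_ne c ∞ with rfl | hc
  · simp
  obtain ⟨ha, hb⟩ := ENNReal.add_ne_top.mp
    (h.trans_lt (ENNReal.mul_lt_top ENNReal.ofNat_lt_top hc.lt_top)).ne
  lift a to NNReal using ha
  lift b to NNReal using hb
  lift c to NNReal using hc
  norm_cast at h ⊢
  have four_mul_le := (four_mul_le_sq_add a b).trans (pow_le_pow_left' h 2)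
  rw [mul_pow, mul_assoc] at four_mul_le
  exact le_of_mul_le_mul_left (by norm_num at four_mul_le ⊢; exact four_mul_le) four_pos

/-- The Prékopa–Leindler inequality for midpoints, as a property of a measure `μ` on a real vector
space. It passes to products, which makes the induction on the dimension possible. -/
def IsMidpointPrekopaLeindler {E : Type*} [AddCommGroup E] [Module ℝ E] [MeasurableSpace E]
    (μ : Measure E) : Prop :=
  ∀ ⦃f g h : E → ℝ≥0∞⦄, Measurable f → Measurable g → Measurable h →
    (∀ x y, f x * g y ≤ h (midpoint ℝ x y) ^ 2) → (∫⁻ x, f x ∂μ) * ∫⁻ x, g x ∂μ ≤ (∫⁻ x, h x ∂μ) ^ 2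

theorem lintegral_mul_lintegral_le_sq_of_iSup_ne_top {f g h : ℝ → ℝ≥0∞} (hf : Measurable f)
    (hg : Measurable g) (hh : Measurable h) (hf_top : ⨆ x, f x ≠ ∞) (hg_top : ⨆ x, g x ≠ ∞)
    (H : ∀ x y, f x * g y ≤ h (midpoint ℝ x y) ^ 2) :
    (∫⁻ x, f x) * ∫⁻ x, g x ≤ (∫⁻ x, h x) ^ 2 := by
  set a := ⨆ x, f x
  set b := ⨆ x, g x
  rcases eq_or_ne a 0 with ha₀ | ha₀
  · simp [ENNReal.iSup_eq_zero.mp ha₀]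
  rcases eq_or_ne b 0 with hb₀ | hb₀
  · simp [ENNReal.iSup_eq_zero.mp hb₀]
  obtain ⟨c, hc⟩ : ∃ c : ℝ≥0∞, c ^ 2 = a * b :=
    ⟨(a * b) ^ (2⁻¹ : ℝ), by rw [← ENNReal.rpow_natCast, ← ENNReal.rpow_mul]; norm_num⟩
  have hc_inv : c⁻¹ ^ 2 = a⁻¹ * b⁻¹ := by
    rw [← ENNReal.inv_pow, hc, ENNReal.mul_inv (.inl ha₀) (.inl hf_top)]
  have H_normalized (x y) : min (a⁻¹ * f x) (b⁻¹ * g y) ≤ c⁻¹ * h (midpoint ℝ x y) := by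
    refine (ENNReal.pow_right_strictMono two_ne_zero).le_iff_le.mp ?_
    calc min (a⁻¹ * f x) (b⁻¹ * g y) ^ 2 ≤ (a⁻¹ * f x) * (b⁻¹ * g y) :=
          (sq _).trans_le (mul_le_mul' (min_le_left _ _) (min_le_right _ _))
      _ = c⁻¹ ^ 2 * (f x * g y) := by rw [hc_inv]; ring
      _ ≤ c⁻¹ ^ 2 * h (midpoint ℝ x y) ^ 2 := by gcongr; exact H x y
      _ = (c⁻¹ * h (midpoint ℝ x y)) ^ 2 := (mul_pow ..).symm
  have normalized := mul_le_sq_of_add_le_two_mul <|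
    lintegral_add_lintegral_le_of_iSup_eq_one (hf.const_mul a⁻¹) (hg.const_mul b⁻¹)
      (hh.const_mul c⁻¹) (by rw [← ENNReal.mul_iSup, ENNReal.inv_mul_cancel ha₀ hf_top])
      (by rw [← ENNReal.mul_iSup, ENNReal.inv_mul_cancel hb₀ hg_top]) H_normalized
  rw [lintegral_const_mul _ hf, lintegral_const_mul _ hg, lintegral_const_mul _ hh, mul_pow,
    hc_inv, mul_mul_mul_comm] at normalized
  exact (ENNReal.mul_le_mul_iff_right (mul_ne_zero (ENNReal.inv_ne_zero.mpr hf_top)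
    (ENNReal.inv_ne_zero.mpr hg_top)) (ENNReal.mul_ne_top (ENNReal.inv_ne_top.mpr ha₀)
    (ENNReal.inv_ne_top.mpr hb₀))).mp normalized

theorem lintegral_eq_iSup_lintegral_min {α : Type*} [MeasurableSpace α] (μ : Measure α)
    {f : α → ℝ≥0∞} (hf : Measurable f) :
    ∫⁻ a, f a ∂μ = ⨆ n : ℕ, ∫⁻ a, min (f a) n ∂μ := by
  rw [← lintegral_iSup (fun n => hf.min measurable_const)
    (fun m n hmn a => min_le_min le_rfl (by exact_mod_cast hmn))]
  refine lintegral_congr fun a => ?_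
  rw [← inf_iSup_eq, ENNReal.iSup_natCast, inf_top_eq]

namespace IsMidpointPrekopaLeindler

theorem volume_real : IsMidpointPrekopaLeindler (volume : Measure ℝ) := by
  intro f g h hf hg hh H
  have iSup_ne_top (u : ℝ → ℝ≥0∞) (n : ℕ) : ⨆ x, min (u x) n ≠ ∞ :=
    ((iSup_le fun _ => min_le_right _ _).trans_lt (ENNReal.natCast_lt_top n)).ne
  rw [lintegral_eq_iSup_lintegral_min _ hf, lintegral_eq_iSup_lintegral_min _ hg,
    ENNReal.iSup_mul]
  refine iSup_le fun m => ?_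
  rw [ENNReal.mul_iSup]
  exact iSup_le fun n => lintegral_mul_lintegral_le_sq_of_iSup_ne_top (hf.min measurable_const)
    (hg.min measurable_const) hh (iSup_ne_top f m) (iSup_ne_top g n) fun x y =>
      (mul_le_mul' (min_le_left _ _) (min_le_left _ _)).trans (H x y)

variable {E F : Type*} [AddCommGroup E] [Module ℝ E] [MeasurableSpace E] {μ : Measure E}
  [AddCommGroup F] [Module ℝ F] [MeasurableSpace F] {ν : Measure F}

theorem prod [SFinite ν] (hμ : IsMidpointPrekopaLeindler μ) (hν : IsMidpointPrekopaLeindler ν) :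
    IsMidpointPrekopaLeindler (μ.prod ν) := by
  intro f g h hf hg hh H
  rw [lintegral_prod _ hf.aemeasurable, lintegral_prod _ hg.aemeasurable,
    lintegral_prod _ hh.aemeasurable]
  refine hμ hf.lintegral_prod_right' hg.lintegral_prod_right' hh.lintegral_prod_right'
    fun x y => hν (hf.comp measurable_prodMk_left) (hg.comp measurable_prodMk_left)
      (hh.comp measurable_prodMk_left) fun s t => ?_
  exact H (x, s) (y, t)

theorem of_measurePreserving (hμ : IsMidpointPrekopaLeindler μ) (L : E →ₗ[ℝ] F)
    (hL : MeasurePreserving L μ ν) : IsMidpointPrekopaLeindler ν := by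
  intro f g h hf hg hh H
  rw [← hL.lintegral_comp hf, ← hL.lintegral_comp hg, ← hL.lintegral_comp hh]
  refine hμ (hf.comp hL.measurable) (hg.comp hL.measurable) (hh.comp hL.measurable) fun x y => ?_
  rw [← L.coe_toAffineMap, AffineMap.map_midpoint]
  exact H _ _

theorem volume_pi : (n : ℕ) → IsMidpointPrekopaLeindler (volume : Measure (Fin n → ℝ))
  | 0 => fun f g h _ _ _ H => by
    have lintegral_eq (u : (Fin 0 → ℝ) → ℝ≥0∞) : ∫⁻ x, u x = u 0 := by
      rw [lintegral_unique, MeasureTheory.volume_pi, Measure.pi_of_empty _ default,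
        measure_univ, mul_one]
      exact congrArg u (Subsingleton.elim _ _)
    simpa only [lintegral_eq, midpoint_self] using H 0 0
  | n + 1 => by
    refine (volume_real.prod (volume_pi n)).of_measurePreserving
      (Fin.consLinearEquiv ℝ fun _ : Fin (n + 1) => ℝ).toLinearMap ?_
    have cons_eq : ⇑(Fin.consLinearEquiv ℝ fun _ : Fin (n + 1) => ℝ).toLinearMap =
        (MeasurableEquiv.piFinSuccAbove (fun _ : Fin (n + 1) => ℝ) 0).symm := by
      ext x : 1
      exact (Fin.insertNth_zero' x.1 x.2).symm
    rw [cons_eq]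
    exact (volume_preserving_piFinSuccAbove (fun _ : Fin (n + 1) => ℝ) 0).symm

theorem volume_euclideanSpace (n : ℕ) :
    IsMidpointPrekopaLeindler (volume : Measure (EuclideanSpace ℝ (Fin n))) :=
  (volume_pi n).of_measurePreserving (WithLp.linearEquiv 2 ℝ (Fin n → ℝ)).symm.toLinearMap
    (PiLp.volume_preserving_toLp (Fin n))

theorem measure_mul_measure_le_sq (hμ : IsMidpointPrekopaLeindler μ) {A B C : Set E}
    (hA : MeasurableSet A) (hB : MeasurableSet B) (hC : MeasurableSet C)
    (h : ∀ a ∈ A, ∀ b ∈ B, midpoint ℝ a b ∈ C) : μ A * μ B ≤ μ C ^ 2 := by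
  rw [← lintegral_indicator_one hA, ← lintegral_indicator_one hB, ← lintegral_indicator_one hC]
  refine hμ (measurable_one.indicator hA) (measurable_one.indicator hB)
    (measurable_one.indicator hC) fun a b => ?_
  by_cases ha : a ∈ A
  · by_cases hb : b ∈ B
    · simp [ha, hb, h a ha b hb]
    · simp [hb]
  · simp [ha]

end IsMidpointPrekopaLeindler

end PrekopaLeindler

theorem euclideanHausdorffMeasure_le_of_mapsTo_of_dist_le {X Y : Type*} [MetricSpace X]
    [MeasurableSpace X] [BorelSpace X] [MetricSpace Y] [MeasurableSpace Y] [BorelSpace Y] (n : ℕ)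
    {f : X → Y} {s : Set X} {t : Set Y} (hf : MapsTo f s t)
    (hdist : ∀ x ∈ s, ∀ y ∈ s, dist x y ≤ dist (f x) (f y)) :
    (μHE[n] : Measure X) s ≤ (μHE[n] : Measure Y) t := by
  have hanti : AntilipschitzWith 1 (s.domRestrict f) :=
    AntilipschitzWith.of_le_mul_dist fun x y => by
      rw [NNReal.coe_one, one_mul]
      exact hdist x x.2 y y.2
  have hle := hanti.le_hausdorffMeasure_image (d := n) n.cast_nonneg univ
  rw [← isometry_subtype_coe.hausdorffMeasure_image (.inl n.cast_nonneg), Subtype.coe_image_univ,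
    ENNReal.coe_one, ENNReal.one_rpow, one_mul, image_univ, range_domRestrict] at hle
  simp only [Measure.euclideanHausdorffMeasure_def, Measure.smul_apply]
  gcongr
  exact hle.trans (measure_mono hf.image_subset)

theorem volume_le_of_mapsTo_of_dist_le {f : ℝ → ℝ} {s t : Set ℝ} (hf : MapsTo f s t)
    (hdist : ∀ x ∈ s, ∀ y ∈ s, dist x y ≤ dist (f x) (f y)) : volume s ≤ volume t := by
  have hle := euclideanHausdorffMeasure_le_of_mapsTo_of_dist_le (Module.finrank ℝ ℝ) hf hdist
  rwa [InnerProductSpace.euclideanHausdorffMeasure_eq_volume] at hle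

section RadialContraction

variable {W : Type*} [NormedAddCommGroup W] [NormedSpace ℝ W]

/-- The part of the cone over `{1} × X`, with apex the origin of `ℝ × W`, below height `M`.
Its volume is a multiple of the measure of `X`. -/
def truncatedCone (X : Set W) (M : ℝ) : Set (ℝ × W) :=
  {p | p.1 ∈ Ioc 0 M ∧ p.1⁻¹ • p.2 ∈ X}

theorem sub_le_perspective_sub {Z : Set W} {Φ : W → ℝ} (hΦ : ConcaveOn ℝ Z Φ) (h₀ : 0 ∈ Z)
    (h₁ : 1 ≤ Φ 0) {w : W} {s t : ℝ} (hs : 0 < s) (hst : s ≤ t) (hsw : s⁻¹ • w ∈ Z) :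
    t - s ≤ t * Φ (t⁻¹ • w) - s * Φ (s⁻¹ • w) := by
  have ht : 0 < t := hs.trans_le hst
  have hconc := hΦ.2 hsw h₀ (div_nonneg hs.le ht.le)
    (sub_nonneg.mpr ((div_le_one ht).mpr hst)) (add_sub_cancel _ _)
  have hcomb : (s / t) • s⁻¹ • w + (1 - s / t) • (0 : W) = t⁻¹ • w := by
    rw [smul_zero, add_zero, smul_smul, div_mul_eq_mul_div, mul_inv_cancel₀ hs.ne', one_div]
  rw [hcomb, smul_eq_mul, smul_eq_mul] at hconc
  calc t - s ≤ (t - s) * Φ 0 := le_mul_of_one_le_right (sub_nonneg.mpr hst) h₁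
    _ = t * (s / t * Φ (s⁻¹ • w) + (1 - s / t) * Φ 0) - s * Φ (s⁻¹ • w) := by field_simp; ring
    _ ≤ t * Φ (t⁻¹ • w) - s * Φ (s⁻¹ • w) := by gcongr

variable [FiniteDimensional ℝ W] [MeasurableSpace W] [BorelSpace W] (μ : Measure W)
  [μ.IsAddHaarMeasure]

theorem measurableSet_truncatedCone {X : Set W} (hX : MeasurableSet X) (M : ℝ) :
    MeasurableSet (truncatedCone X M) :=
  (measurable_fst measurableSet_Ioc).inter ((measurable_fst.inv.smul measurable_snd) hX)

theorem measure_truncatedCone {X : Set W} (hX : MeasurableSet X) {M : ℝ} (hM : 0 ≤ M) :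
    ((volume : Measure ℝ).prod μ) (truncatedCone X M) =
      ENNReal.ofReal (M ^ (Module.finrank ℝ W + 1) / (Module.finrank ℝ W + 1)) * μ X := by
  have measure_slice (l : ℝ) : μ (Prod.mk l ⁻¹' truncatedCone X M) =
      (Ioc 0 M).indicator (fun l => ENNReal.ofReal (l ^ Module.finrank ℝ W) * μ X) l := by
    by_cases hl : l ∈ Ioc 0 M
    · have slice_eq : Prod.mk l ⁻¹' truncatedCone X M = (fun w => l⁻¹ • w) ⁻¹' X := by
        ext w
        simp only [truncatedCone, mem_preimage, mem_ofPred_eq, hl, true_and]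
      rw [indicator_of_mem hl, slice_eq, Measure.addHaar_preimage_smul _ (inv_ne_zero hl.1.ne'),
        inv_pow, inv_inv, abs_of_nonneg (pow_nonneg hl.1.le _)]
    · have slice_eq : Prod.mk l ⁻¹' truncatedCone X M = ∅ := by
        ext w
        simp only [truncatedCone, mem_preimage, mem_ofPred_eq, hl, false_and, mem_empty_iff_false]
      rw [indicator_of_notMem hl, slice_eq, measure_empty]
  rw [Measure.prod_apply (measurableSet_truncatedCone hX M), lintegral_congr measure_slice,
    lintegral_indicator measurableSet_Ioc, lintegral_mul_const _ (by fun_prop),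
    ← ofReal_integral_eq_lintegral_ofReal]
  · rw [← intervalIntegral.integral_of_le hM, integral_pow]
    simp
  · rw [← IntegrableOn, ← intervalIntegrable_iff_integrableOn_Ioc_of_le hM]
    exact (continuous_pow _).intervalIntegrable _ _
  · exact (ae_restrict_iff' measurableSet_Ioc).mpr
      (.of_forall fun l hl => pow_nonneg hl.1.le _)

/-- On each line `ℝ × {w}` the perspective map `l ↦ l * Φ (l⁻¹ • w)` expands lengths and carries
the cone over `A` into the cone over `B`; comparing volumes of cones gives the result. -/
theorem measure_le_of_radial_contraction {Z A B : Set W} {Φ : W → ℝ} {L : ℝ}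
    (hΦ : ConcaveOn ℝ Z Φ) (h₀ : 0 ∈ Z) (h₁ : 1 ≤ Φ 0) (hA : MeasurableSet A) (hAZ : A ⊆ Z)
    (hpos : ∀ z ∈ A, 0 < Φ z) (hL : ∀ z ∈ A, Φ z ≤ L) (hAB : ∀ z ∈ A, (Φ z)⁻¹ • z ∈ B) :
    μ A ≤ ENNReal.ofReal (L ^ (Module.finrank ℝ W + 1)) * μ B := by
  rcases A.eq_empty_or_nonempty with rfl | ⟨a, ha⟩
  · simp
  have hL₀ : 0 < L := (hpos a ha).trans_le (hL a ha)
  have hB : MeasurableSet (toMeasurable μ B) := measurableSet_toMeasurable μ B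
  have cone_le : ((volume : Measure ℝ).prod μ) (truncatedCone A 1) ≤
      ((volume : Measure ℝ).prod μ) (truncatedCone (toMeasurable μ B) L) := by
    rw [Measure.prod_apply_symm (measurableSet_truncatedCone hA 1),
      Measure.prod_apply_symm (measurableSet_truncatedCone hB L)]
    refine lintegral_mono fun w => volume_le_of_mapsTo_of_dist_le
      (f := fun l => l * Φ (l⁻¹ • w)) ?_ ?_
    · rintro l ⟨⟨hl₀, hl₁⟩, hlA⟩
      refine ⟨⟨mul_pos hl₀ (hpos _ hlA), ?_⟩, subset_toMeasurable μ B ?_⟩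
      · exact (mul_le_of_le_one_left (hpos _ hlA).le hl₁).trans (hL _ hlA)
      · simpa [smul_smul, mul_inv, mul_comm] using hAB _ hlA
    · rintro s hs t ht
      wlog hst : s ≤ t generalizing s t
      · rw [dist_comm, dist_comm (s * _)]
        exact this t ht s hs (le_of_not_ge hst)
      rw [dist_comm, dist_comm (s * _), Real.dist_eq, abs_of_nonneg (sub_nonneg.mpr hst)]
      exact (sub_le_perspective_sub hΦ h₀ h₁ hs.1.1 hst (hAZ hs.2)).trans (le_abs_self _)
  rw [measure_truncatedCone μ hA zero_le_one, measure_truncatedCone μ hB hL₀.le,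
    measure_toMeasurable, one_pow, div_eq_mul_inv (L ^ _), ENNReal.ofReal_mul (by positivity),
    one_div, mul_comm (ENNReal.ofReal (L ^ _)), mul_assoc] at cone_le
  exact (ENNReal.mul_le_mul_iff_right (by simpa using by positivity)
    ENNReal.ofReal_ne_top).mp cone_le

end RadialContraction

section LogConcaveTail

variable {α : Type*} [MeasurableSpace α] {ν : Measure α} [IsFiniteMeasure ν] {ψ : α → ℝ}

theorem integral_le_mul_measureReal_univ_add_setIntegral (hψ : Measurable ψ)
    (hint : Integrable ψ ν) {c : ℝ} (hc : 0 ≤ c) :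
    ∫ a, ψ a ∂ν ≤ c * ν.real univ + ∫ a in {a | c ≤ ψ a}, ψ a ∂ν := by
  have hmeas : MeasurableSet {a | c ≤ ψ a} := measurableSet_le measurable_const hψ
  calc ∫ a, ψ a ∂ν ≤ ∫ a, (c + {a | c ≤ ψ a}.indicator ψ a) ∂ν := by
        refine integral_mono hint ((integrable_const c).add (hint.indicator hmeas)) fun a => ?_
        by_cases ha : c ≤ ψ a
        · simpa [indicator, ha] using hc
        · simpa [indicator, ha] using le_of_not_ge ha
    _ = c * ν.real univ + ∫ a in {a | c ≤ ψ a}, ψ a ∂ν := by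
        rw [integral_add (integrable_const c) (hint.indicator hmeas), integral_const,
          integral_indicator hmeas, smul_eq_mul, mul_comm]

/-- Doubling `t` divides the tail `ν {t ≤ ψ}` by at least `8`, so the dyadic layers of the
integral decay geometrically. -/
theorem setIntegral_superlevel_le (hψ : Measurable ψ) (hint : Integrable ψ ν)
    (htail : ∀ t > 0, ν.real {a | 2 * t ≤ ψ a} * ν.real univ ≤ ν.real {a | t ≤ ψ a} ^ 2)
    (hν : 0 < ν.real univ) {b : ℝ} (hb : ∀ a, ψ a ≤ b) (k : ℕ) {t : ℝ} (ht : 0 < t)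
    (hbt : b < 2 ^ k * t) (hsmall : ν.real {a | t ≤ ψ a} ≤ ν.real univ / 8) :
    ∫ a in {a | t ≤ ψ a}, ψ a ∂ν ≤ 4 * t * ν.real {a | t ≤ ψ a} := by
  induction k generalizing t with
  | zero =>
    have hempty : {a | t ≤ ψ a} = ∅ := eq_empty_of_forall_notMem fun a ha =>
      (ha.trans (hb a)).not_gt (by simpa using hbt)
    simp [hempty]
  | succ k ih =>
    have hdouble : ν.real {a | 2 * t ≤ ψ a} ≤ ν.real {a | t ≤ ψ a} / 8 := by
      refine le_of_mul_le_mul_right ((htail t ht).trans ?_) hν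
      rw [sq, div_mul_eq_mul_div, mul_div_assoc]
      exact mul_le_mul_of_nonneg_left hsmall measureReal_nonneg
    have htop := ih (t := 2 * t) (by positivity) (by rwa [← mul_assoc, ← pow_succ])
      (by linarith [measureReal_nonneg (μ := ν) (s := {a | t ≤ ψ a})])
    have hsplit := integral_le_mul_measureReal_univ_add_setIntegral hψ
      hint.restrict (ν := ν.restrict {a | t ≤ ψ a}) (c := 2 * t) (by positivity)
    have hsub : {a | 2 * t ≤ ψ a} ⊆ {a | t ≤ ψ a} := fun a ha =>
      (by linarith : t ≤ 2 * t).trans ha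
    rw [Measure.restrict_restrict_of_subset hsub, measureReal_restrict_apply_univ] at hsplit
    linarith [mul_le_mul_of_nonneg_left hdouble ht.le,
      mul_nonneg ht.le (measureReal_nonneg (μ := ν) (s := {a | t ≤ ψ a}))]

theorem measureReal_univ_div_eight_lt_superlevel (hψ : Measurable ψ) (hint : Integrable ψ ν)
    {b : ℝ} (hb : ∀ a, ψ a ≤ b)
    (htail : ∀ t > 0, ν.real {a | 2 * t ≤ ψ a} * ν.real univ ≤ ν.real {a | t ≤ ψ a} ^ 2)
    (hν : 0 < ν.real univ) {m : ℝ} (hm : 0 < m) (hmean : ∫ a, ψ a ∂ν = m * ν.real univ) :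
    ν.real univ / 8 < ν.real {a | m / 4 ≤ ψ a} := by
  by_contra! hsmall
  obtain ⟨k, hk⟩ := pow_unbounded_of_one_lt (b / (m / 4)) (one_lt_two (α := ℝ))
  have hlow := integral_le_mul_measureReal_univ_add_setIntegral hψ hint
    (c := m / 4) (by positivity)
  have htop := setIntegral_superlevel_le hψ hint htail hν hb k (t := m / 4) (by positivity)
    ((div_lt_iff₀ (by positivity)).mp hk) hsmall
  rw [hmean] at hlow
  linarith [mul_le_mul_of_nonneg_left hsmall hm.le, mul_pos hm hν]

theorem measureReal_univ_div_sixteen_le_of_tail (hψ : Measurable ψ) (hψ₀ : 0 ≤ ψ) {b : ℝ}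
    (hb : ∀ a, ψ a ≤ b)
    (htail : ∀ t > 0, ν.real {a | 2 * t ≤ ψ a} * ν.real univ ≤ ν.real {a | t ≤ ψ a} ^ 2)
    (hν : 0 < ν.real univ) {m : ℝ} (hm : 0 < m) (hmean : ∫ a, ψ a ∂ν = m * ν.real univ)
    {c : ℝ} (hc : 16 * m ≤ c) :
    ν.real univ / 16 ≤ ν.real {a | m / 4 ≤ ψ a ∧ ψ a ≤ c} := by
  have hint : Integrable ψ ν := .of_bound hψ.aestronglyMeasurable b <| .of_forall fun a => by
    rw [Real.norm_of_nonneg (hψ₀ a)]; exact hb a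
  have hlow := measureReal_univ_div_eight_lt_superlevel hψ hint hb htail hν hm hmean
  have hhigh : ν.real {a | c ≤ ψ a} ≤ ν.real univ / 16 := by
    have hmarkov := mul_meas_ge_le_integral_of_nonneg (.of_forall hψ₀) hint c
    rw [hmean] at hmarkov
    have := (mul_le_mul_of_nonneg_right hc measureReal_nonneg).trans hmarkov
    exact le_of_mul_le_mul_left (by linarith) hm
  have hcover : {a | m / 4 ≤ ψ a} ⊆ {a | m / 4 ≤ ψ a ∧ ψ a ≤ c} ∪ {a | c ≤ ψ a} :=
    fun a ha => (le_total (ψ a) c).imp_left fun h => ⟨ha, h⟩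
  linarith [(measureReal_mono hcover).trans (measureReal_union_le (μ := ν) _ _)]

end LogConcaveTail

section LowerBoundary

variable {W : Type*}

/-- The lowest height of a point of `C` above `z`, and `0` if there is no such point. -/
noncomputable def lowerHeight (C : Set (W × ℝ)) (z : W) : ℝ :=
  sInf {t | (z, t) ∈ C}

/-- The lowest point of `C` above `z`, the counterpart of the point `π_K(x, z)` of the statement. -/
noncomputable def lowerPoint (C : Set (W × ℝ)) (z : W) : W × ℝ :=
  (z, lowerHeight C z)

variable {C : Set (W × ℝ)} {z : W}

theorem lowerHeight_of_notMem (hz : z ∉ Prod.fst '' C) : lowerHeight C z = 0 := by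
  have hempty : {t | (z, t) ∈ C} = ∅ :=
    eq_empty_of_forall_notMem fun t ht => hz ⟨(z, t), ht, rfl⟩
  rw [lowerHeight, hempty, Real.sInf_empty]

variable [NormedAddCommGroup W]

theorem isLeast_lowerHeight (hC : IsCompact C) (hz : z ∈ Prod.fst '' C) :
    IsLeast {t | (z, t) ∈ C} (lowerHeight C z) := by
  obtain ⟨⟨z, t⟩, ht, rfl⟩ := hz
  have hclosed : IsClosed {t | (z, t) ∈ C} := hC.isClosed.preimage (by fun_prop)
  have hbdd : BddBelow {t | (z, t) ∈ C} :=
    (hC.image continuous_snd).bddBelow.mono fun _ hs => mem_image_of_mem Prod.snd hs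
  exact ⟨hclosed.csInf_mem ⟨t, ht⟩ hbdd, fun s hs => csInf_le hbdd hs⟩

theorem lowerPoint_mem (hC : IsCompact C) (hz : z ∈ Prod.fst '' C) : lowerPoint C z ∈ C :=
  (isLeast_lowerHeight hC hz).1

theorem lowerPoint_ne_zero_one (hC : IsCompact C) (h₀ : (0, 0) ∈ C) :
    lowerPoint C z ≠ (0, 1) := by
  intro h
  obtain ⟨rfl, h₁⟩ := Prod.mk.inj h
  have hle := (isLeast_lowerHeight hC ⟨(0, 0), h₀, rfl⟩).2 h₀
  exact zero_lt_one.not_ge (h₁ ▸ hle)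

theorem measurable_lowerHeight [MeasurableSpace W] [BorelSpace W] (hC : IsCompact C) :
    Measurable (lowerHeight C) := by
  refine measurable_of_Iic fun c => ?_
  have hshadow : MeasurableSet (Prod.fst '' C) := (hC.image continuous_fst).measurableSet
  have hsublevel : MeasurableSet (Prod.fst '' (C ∩ {p : W × ℝ | p.2 ≤ c})) :=
    ((hC.inter_right (isClosed_le continuous_snd continuous_const)).image
      continuous_fst).measurableSet
  have preimage_eq : lowerHeight C ⁻¹' Iic c =
      Prod.fst '' (C ∩ {p : W × ℝ | p.2 ≤ c}) ∪ ((Prod.fst '' C)ᶜ ∩ {_z | 0 ≤ c}) := by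
    ext z
    by_cases hz : z ∈ Prod.fst '' C
    · have hleast := isLeast_lowerHeight hC hz
      refine ⟨fun h => .inl ⟨lowerPoint C z, ⟨hleast.1, h⟩, rfl⟩, ?_⟩
      rintro (⟨⟨z, t⟩, ⟨hmem, ht⟩, rfl⟩ | ⟨hz', -⟩)
      · exact (hleast.2 hmem).trans ht
      · exact absurd hz hz'
    · have hz' : z ∉ Prod.fst '' (C ∩ {p : W × ℝ | p.2 ≤ c}) := fun h =>
        hz (image_mono inter_subset_left h)
      simp only [mem_preimage, lowerHeight_of_notMem hz, mem_Iic, mem_union, hz', mem_inter_iff,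
        mem_compl_iff, hz, not_false_eq_true, mem_ofPred_eq, true_and, false_or]
  rw [preimage_eq]
  exact hsublevel.union (hshadow.compl.inter (.const _))

theorem notMem_interior_of_path {X : Type*} [TopologicalSpace X] {S : Set X} {γ : ℝ → X}
    (hγ : Continuous γ) {a b : ℝ} (hab : a < b) (h : ∀ t ∈ Ioo a b, γ t ∉ S) :
    γ a ∉ interior S := by
  intro ha
  have hev : ∀ᶠ t in nhdsWithin a (Ioi a), γ t ∈ interior S :=
    (hγ.tendsto a).mono_left nhdsWithin_le_nhds (isOpen_interior.mem_nhds ha)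
  obtain ⟨t, ht, htab⟩ := (hev.and (Ioo_mem_nhdsGT hab)).exists
  exact h t htab (interior_subset ht)

theorem lowerPoint_mem_frontier (hC : IsCompact C) (hz : z ∈ Prod.fst '' C) :
    lowerPoint C z ∈ frontier C := by
  rw [hC.isClosed.frontier_eq]
  refine ⟨lowerPoint_mem hC hz, ?_⟩
  have hbelow := notMem_interior_of_path (S := C) (γ := fun t : ℝ => (z, lowerHeight C z - t))
    (by fun_prop) one_pos fun t ht hmem =>
      ((isLeast_lowerHeight hC hz).2 hmem).not_gt (sub_lt_self _ ht.1)
  rwa [sub_zero] at hbelow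

end LowerBoundary

section Depth

variable {W : Type*} [NormedAddCommGroup W] [NormedSpace ℝ W]

/-- The parameters `s ∈ [0, 1]` at which the segment from the lowest point of `C` above `z` to the
point `(0, 1)` is in `C`; empty if no point of `C` lies above `z`. -/
def depthSet (C : Set (W × ℝ)) (z : W) : Set ℝ :=
  {s | z ∈ Prod.fst '' C ∧ s ∈ Icc (0 : ℝ) 1 ∧ AffineMap.lineMap (lowerPoint C z) (0, 1) s ∈ C}

/-- The depth/distance ratio `Ψ`: the fraction of the segment from the lowest point of `C` above
`z` to the point `(0, 1)` that is in the convex set `C`, and `0` if no point of `C` lies above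
`z`. -/
noncomputable def depth (C : Set (W × ℝ)) (z : W) : ℝ :=
  sSup (depthSet C z)

/-- The point at which the segment from the lowest point of `C` above `z` to the point `(0, 1)`
leaves `C`. -/
noncomputable def exitPoint (C : Set (W × ℝ)) (z : W) : W × ℝ :=
  AffineMap.lineMap (lowerPoint C z) (0, 1) (depth C z)

variable {C : Set (W × ℝ)} {z : W}

theorem lineMap_zero_one (z : W) (t s : ℝ) :
    AffineMap.lineMap (z, t) ((0 : W), (1 : ℝ)) s = ((1 - s) • z, (1 - s) * t + s) := by
  simp [AffineMap.lineMap_apply_module]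

theorem fst_exitPoint : (exitPoint C z).1 = (1 - depth C z) • z := by
  rw [exitPoint, lowerPoint, lineMap_zero_one]

theorem depth_nonneg : 0 ≤ depth C z :=
  Real.sSup_nonneg fun _ hs => hs.2.1.1

theorem depth_le_one : depth C z ≤ 1 :=
  Real.sSup_le (fun _ hs => hs.2.1.2) zero_le_one

theorem depth_of_notMem (hz : z ∉ Prod.fst '' C) : depth C z = 0 := by
  rw [depth, eq_empty_of_forall_notMem (s := depthSet C z) fun _ hs => hz hs.1, Real.sSup_empty]

theorem mem_fst_image_of_depth_pos (h : 0 < depth C z) : z ∈ Prod.fst '' C := by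
  by_contra hz
  exact h.ne' (depth_of_notMem hz)

theorem depth_mem_depthSet (hC : IsCompact C) (hz : z ∈ Prod.fst '' C) :
    depth C z ∈ depthSet C z := by
  have hcompact : IsCompact (depthSet C z) := by
    simp only [depthSet, hz, true_and]
    exact isCompact_Icc.inter_right (hC.isClosed.preimage AffineMap.lineMap_continuous)
  exact hcompact.sSup_mem
    ⟨0, hz, left_mem_Icc.mpr zero_le_one, by simpa using lowerPoint_mem hC hz⟩

theorem ordConnected_depthSet (hconv : Convex ℝ C) : (depthSet C z).OrdConnected := by
  by_cases hz : z ∈ Prod.fst '' C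
  · simp only [depthSet, hz, true_and]
    exact ((convex_Icc 0 1).inter (hconv.affine_preimage _)).ordConnected
  · simp only [depthSet, hz, false_and, ofPred_false]
    exact ordConnected_empty

theorem le_depth_iff_lineMap_mem (hC : IsCompact C) (hconv : Convex ℝ C)
    (hz : z ∈ Prod.fst '' C) {s : ℝ} (hs : s ∈ Icc (0 : ℝ) 1) :
    s ≤ depth C z ↔ AffineMap.lineMap (lowerPoint C z) (0, 1) s ∈ C := by
  refine ⟨fun h => ?_, fun h => le_csSup ⟨1, fun _ hs => hs.2.1.2⟩ ⟨hz, hs, h⟩⟩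
  have h₀ : (0 : ℝ) ∈ depthSet C z :=
    ⟨hz, left_mem_Icc.mpr zero_le_one, by simpa using lowerPoint_mem hC hz⟩
  exact ((ordConnected_depthSet hconv).out h₀ (depth_mem_depthSet hC hz) ⟨hs.1, h⟩).2.2

theorem depth_lt_one (hC : IsCompact C) (h₁ : ((0 : W), (1 : ℝ)) ∉ C) : depth C z < 1 := by
  refine depth_le_one.lt_of_ne fun h => ?_
  have hmem := (depth_mem_depthSet hC (mem_fst_image_of_depth_pos (h ▸ zero_lt_one))).2.2
  rw [h, AffineMap.lineMap_apply_one] at hmem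
  exact h₁ hmem

theorem exitPoint_mem_frontier (hC : IsCompact C) (hconv : Convex ℝ C)
    (h₁ : ((0 : W), (1 : ℝ)) ∉ C) (hz : z ∈ Prod.fst '' C) : exitPoint C z ∈ frontier C := by
  rw [hC.isClosed.frontier_eq]
  refine ⟨(depth_mem_depthSet hC hz).2.2, ?_⟩
  refine notMem_interior_of_path AffineMap.lineMap_continuous (depth_lt_one hC h₁)
    fun s hs hmem => hs.1.not_ge ?_
  exact (le_depth_iff_lineMap_mem hC hconv hz ⟨depth_nonneg.trans hs.1.le, hs.2.le⟩).mpr hmem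

/-- It suffices to find a point of `C` vertically above the point in question, because the point of
the segment from the lowest point to the origin vertically below it is in `C`. -/
theorem lineMap_lowerPoint_mem_of_le (hC : IsCompact C) (hconv : Convex ℝ C) (h₀ : (0, 0) ∈ C)
    (hz : z ∈ Prod.fst '' C) {s u : ℝ} (hs : s ∈ Icc (0 : ℝ) 1)
    (hu : (1 - s) * lowerHeight C z + s ≤ u) (hmem : ((1 - s) • z, u) ∈ C) :
    AffineMap.lineMap (lowerPoint C z) (0, 1) s ∈ C := by
  have hbelow : ((1 - s) • z, (1 - s) * lowerHeight C z) ∈ C := by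
    simpa [lowerPoint] using hconv (lowerPoint_mem hC hz) h₀ (sub_nonneg.mpr hs.2) hs.1
      (sub_add_cancel 1 s)
  have hvertical : OrdConnected {t : ℝ | ((1 - s) • z, t) ∈ C} :=
    (hconv.affine_preimage ((AffineMap.const ℝ ℝ ((1 - s) • z)).prod (.id ℝ ℝ))).ordConnected
  rw [lowerPoint, lineMap_zero_one]
  exact hvertical.out hbelow hmem ⟨le_add_of_nonneg_right hs.1, hu⟩

theorem le_depth_iff_exists_mem (hC : IsCompact C) (hconv : Convex ℝ C) (h₀ : (0, 0) ∈ C)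
    (hz : z ∈ Prod.fst '' C) {s : ℝ} (hs : s ∈ Icc (0 : ℝ) 1) :
    s ≤ depth C z ↔
      ∃ t, (z, t) ∈ C ∧ AffineMap.lineMap (z, t) ((0 : W), (1 : ℝ)) s ∈ C := by
  refine ⟨fun h => ⟨lowerHeight C z, lowerPoint_mem hC hz,
    (le_depth_iff_lineMap_mem hC hconv hz hs).mp h⟩, ?_⟩
  rintro ⟨t, ht, hst⟩
  rw [lineMap_zero_one] at hst
  refine (le_depth_iff_lineMap_mem hC hconv hz hs).mpr
    (lineMap_lowerPoint_mem_of_le hC hconv h₀ hz hs ?_ hst)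
  gcongr
  · exact sub_nonneg.mpr hs.2
  · exact (isLeast_lowerHeight hC hz).2 ht

theorem setOf_le_depth_eq_image (hC : IsCompact C) (hconv : Convex ℝ C) (h₀ : (0, 0) ∈ C) {s : ℝ}
    (hs : s ∈ Ioc (0 : ℝ) 1) :
    {z | s ≤ depth C z} =
      Prod.fst '' (C ∩ {p | AffineMap.lineMap p ((0 : W), (1 : ℝ)) s ∈ C}) := by
  have hs' : s ∈ Icc (0 : ℝ) 1 := Ioc_subset_Icc_self hs
  ext z
  constructor
  · intro h
    obtain ⟨t, ht, hst⟩ := (le_depth_iff_exists_mem hC hconv h₀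
      (mem_fst_image_of_depth_pos (hs.1.trans_le h)) hs').mp h
    exact ⟨(z, t), ⟨ht, hst⟩, rfl⟩
  · rintro ⟨⟨z, t⟩, ⟨ht, hst⟩, rfl⟩
    exact (le_depth_iff_exists_mem hC hconv h₀ ⟨(z, t), ht, rfl⟩ hs').mpr ⟨t, ht, hst⟩

theorem measurable_depth [MeasurableSpace W] [BorelSpace W] (hC : IsCompact C)
    (hconv : Convex ℝ C) (h₀ : (0, 0) ∈ C) : Measurable (depth C) := by
  refine measurable_of_Ici fun s => ?_
  rcases le_or_gt s 0 with hs₀ | hs₀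
  · rw [preimage_eq_univ_iff.mpr fun _ ⟨_, h⟩ => hs₀.trans (h ▸ depth_nonneg)]
    exact .univ
  rcases le_or_gt s 1 with hs₁ | hs₁
  · have hclosed : IsClosed {p | AffineMap.lineMap p ((0 : W), (1 : ℝ)) s ∈ C} :=
      hC.isClosed.preimage (by fun_prop)
    change MeasurableSet {z | s ≤ depth C z}
    rw [setOf_le_depth_eq_image hC hconv h₀ ⟨hs₀, hs₁⟩]
    exact ((hC.inter_right hclosed).image continuous_fst).measurableSet
  · rw [preimage_eq_empty_iff.mpr (disjoint_left.mpr fun _ hr ⟨_, h⟩ =>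
      (hs₁.trans_le hr).not_ge (h ▸ depth_le_one))]
    exact .empty

theorem inv_smul_eq_lineMap (z : W) (t : ℝ) {φ : ℝ} (hφ : φ ≠ 0) :
    φ⁻¹ • (z, t + φ - 1) = AffineMap.lineMap (z, t) ((0 : W), (1 : ℝ)) (1 - φ⁻¹) := by
  rw [lineMap_zero_one, sub_sub_cancel, Prod.smul_mk, smul_eq_mul, add_sub_assoc, mul_add, mul_sub,
    inv_mul_cancel₀ hφ, mul_one]

theorem le_inv_one_sub_depth_iff (hC : IsCompact C) (hconv : Convex ℝ C) (h₀ : (0, 0) ∈ C)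
    (h₁ : ((0 : W), (1 : ℝ)) ∉ C) (hz : z ∈ Prod.fst '' C) {φ : ℝ} (hφ : 1 ≤ φ) :
    φ ≤ (1 - depth C z)⁻¹ ↔ ∃ t, (z, t) ∈ C ∧ φ⁻¹ • (z, t + φ - 1) ∈ C := by
  have hφ₀ : 0 < φ := zero_lt_one.trans_le hφ
  simp only [inv_smul_eq_lineMap z _ hφ₀.ne']
  rw [← le_depth_iff_exists_mem hC hconv h₀ hz
    ⟨sub_nonneg.mpr (inv_le_one_of_one_le₀ hφ), sub_le_self _ (inv_nonneg.mpr hφ₀.le)⟩,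
    le_inv_comm₀ hφ₀ (sub_pos.mpr (depth_lt_one hC h₁)), sub_le_comm]

theorem one_le_inv_one_sub_depth (hC : IsCompact C) (h₁ : ((0 : W), (1 : ℝ)) ∉ C) :
    1 ≤ (1 - depth C z)⁻¹ :=
  (one_le_inv₀ (sub_pos.mpr (depth_lt_one hC h₁))).mpr (sub_le_self _ depth_nonneg)

theorem inv_add_smul_add_mem {E : Type*} [AddCommGroup E] [Module ℝ E] {S : Set E}
    (hS : Convex ℝ S) {a b : ℝ} (ha : 0 < a) (hb : 0 < b) {x y : E} (hx : a⁻¹ • x ∈ S)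
    (hy : b⁻¹ • y ∈ S) : (a + b)⁻¹ • (x + y) ∈ S := by
  have hab : 0 < a + b := add_pos ha hb
  convert hS hx hy (div_nonneg ha.le hab.le) (div_nonneg hb.le hab.le) (by field_simp) using 1
  rw [smul_smul, smul_smul, div_mul_eq_mul_div, div_mul_eq_mul_div, mul_inv_cancel₀ ha.ne',
    mul_inv_cancel₀ hb.ne', one_div, smul_add]

theorem concaveOn_inv_one_sub_depth (hC : IsCompact C) (hconv : Convex ℝ C) (h₀ : (0, 0) ∈ C)
    (h₁ : ((0 : W), (1 : ℝ)) ∉ C) :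
    ConcaveOn ℝ (Prod.fst '' C) fun z => (1 - depth C z)⁻¹ := by
  have hshadow : Convex ℝ (Prod.fst '' C) := hconv.linear_image (LinearMap.fst ℝ W ℝ)
  refine concaveOn_iff_forall_pos.mpr ⟨hshadow, fun y hy z hz a b ha hb hab => ?_⟩
  simp only [smul_eq_mul]
  set φ := (1 - depth C y)⁻¹ with hφ
  set χ := (1 - depth C z)⁻¹ with hχ
  have hφ₁ : 1 ≤ φ := one_le_inv_one_sub_depth hC h₁
  have hχ₁ : 1 ≤ χ := one_le_inv_one_sub_depth hC h₁
  have hone : 1 ≤ a * φ + b * χ := by nlinarith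
  obtain ⟨t, ht, hst⟩ := (le_inv_one_sub_depth_iff hC hconv h₀ h₁ hy hφ₁).mp hφ.le
  obtain ⟨u, hu, hsu⟩ := (le_inv_one_sub_depth_iff hC hconv h₀ h₁ hz hχ₁).mp hχ.le
  refine (le_inv_one_sub_depth_iff hC hconv h₀ h₁ (hshadow hy hz ha.le hb.le hab) hone).mpr
    ⟨a * t + b * u, hconv ht hu ha.le hb.le hab, ?_⟩
  have scale {c ω : ℝ} (hc : 0 < c) {p : W × ℝ} (hp : ω⁻¹ • p ∈ C) :
      (c * ω)⁻¹ • c • p ∈ C := by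
    rwa [smul_smul, mul_inv_rev, inv_mul_cancel_right₀ hc.ne']
  convert inv_add_smul_add_mem hconv (by positivity) (by positivity) (scale ha hst)
    (scale hb hsu) using 2
  ext
  · rfl
  · simp only [Prod.snd_add, Prod.smul_snd, smul_eq_mul]
    linear_combination hab

theorem concaveOn_depth (hC : IsCompact C) (hconv : Convex ℝ C) (h₀ : (0, 0) ∈ C)
    (h₁ : ((0 : W), (1 : ℝ)) ∉ C) : ConcaveOn ℝ (Prod.fst '' C) (depth C) := by
  have hΦ := concaveOn_inv_one_sub_depth hC hconv h₀ h₁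
  refine ⟨hΦ.1, fun y hy z hz a b ha hb hab => ?_⟩
  have pos (z) : 0 < (1 - depth C z)⁻¹ := inv_pos.mpr (sub_pos.mpr (depth_lt_one hC h₁))
  have hharmonic := (convexOn_zpow (𝕜 := ℝ) (-1)).2 (pos y) (pos z) ha hb hab
  have hinv := inv_anti₀ ((convex_Ioi (0 : ℝ)) (pos y) (pos z) ha hb hab) (hΦ.2 hy hz ha hb hab)
  simp only [zpow_neg_one, inv_inv, smul_eq_mul] at hharmonic hinv ⊢
  linarith

variable [MeasurableSpace W] [BorelSpace W]

theorem measure_le_measure_image_exitPoint [FiniteDimensional ℝ W] (μ : Measure W)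
    [μ.IsAddHaarMeasure] (hC : IsCompact C) (hconv : Convex ℝ C) (h₀ : (0, 0) ∈ C)
    (h₁ : ((0 : W), (1 : ℝ)) ∉ C) {A : Set W} (hA : MeasurableSet A) (hAC : A ⊆ Prod.fst '' C)
    {c : ℝ} (hc : c < 1) (hAc : ∀ z ∈ A, depth C z ≤ c) :
    μ A ≤ ENNReal.ofReal ((1 - c)⁻¹ ^ (Module.finrank ℝ W + 1)) *
      μ ((fun z => (exitPoint C z).1) '' A) := by
  refine measure_le_of_radial_contraction μ (concaveOn_inv_one_sub_depth hC hconv h₀ h₁)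
    ⟨(0, 0), h₀, rfl⟩ (one_le_inv_one_sub_depth hC h₁) hA hAC
    (fun z _ => inv_pos.mpr (sub_pos.mpr (depth_lt_one hC h₁)))
    (fun z hz => inv_anti₀ (sub_pos.mpr hc) (sub_le_sub_left (hAc z hz) 1)) fun z hz => ⟨z, hz, ?_⟩
  simp only [fst_exitPoint, inv_inv]

theorem IsMidpointPrekopaLeindler.measure_depth_mul_measure_le_sq {μ : Measure W}
    (hμ : IsMidpointPrekopaLeindler μ) (hC : IsCompact C) (hconv : Convex ℝ C) (h₀ : (0, 0) ∈ C)
    (h₁ : ((0 : W), (1 : ℝ)) ∉ C) {t : ℝ} (ht : 0 < t) :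
    μ {z | 2 * t ≤ depth C z} * μ (Prod.fst '' C) ≤ μ {z | t ≤ depth C z} ^ 2 := by
  have hmeas (t : ℝ) : MeasurableSet {z | t ≤ depth C z} :=
    measurableSet_le measurable_const (measurable_depth hC hconv h₀)
  refine hμ.measure_mul_measure_le_sq (hmeas _) (hC.image continuous_fst).measurableSet
    (hmeas _) fun y (hy : 2 * t ≤ depth C y) z hz => ?_
  have hconc := (concaveOn_depth hC hconv h₀ h₁).2
    (mem_fst_image_of_depth_pos ((mul_pos two_pos ht).trans_le hy)) hz
    (by norm_num : (0 : ℝ) ≤ 2⁻¹) (by norm_num : (0 : ℝ) ≤ 2⁻¹) (by norm_num)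
  rw [mem_ofPred_eq, midpoint_eq_smul_add, invOf_eq_inv, smul_add]
  simp only [smul_eq_mul] at hconc
  linarith [depth_nonneg (C := C) (z := z)]

theorem IsMidpointPrekopaLeindler.measureReal_div_sixteen_le_depth_preimage_Icc {μ : Measure W}
    [IsFiniteMeasureOnCompacts μ] (hμ : IsMidpointPrekopaLeindler μ) (hC : IsCompact C)
    (hconv : Convex ℝ C) (h₀ : (0, 0) ∈ C) (h₁ : ((0 : W), (1 : ℝ)) ∉ C)
    (hpos : 0 < μ.real (Prod.fst '' C)) {m c : ℝ} (hm : 0 < m)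
    (hmean : ∫ z in Prod.fst '' C, depth C z ∂μ = m * μ.real (Prod.fst '' C))
    (hc : 16 * m ≤ c) :
    μ.real (Prod.fst '' C) / 16 ≤ μ.real (depth C ⁻¹' Icc (m / 4) c) := by
  have hdepth : Measurable (depth C) := measurable_depth hC hconv h₀
  have hfin : μ (Prod.fst '' C) ≠ ⊤ := (hC.image continuous_fst).measure_ne_top
  have : IsFiniteMeasure (μ.restrict (Prod.fst '' C)) := isFiniteMeasure_restrict.mpr hfin
  have superlevel_inter {t : ℝ} (ht : 0 < t) :
      {z | t ≤ depth C z} ∩ Prod.fst '' C = {z | t ≤ depth C z} :=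
    inter_eq_left.mpr fun z hz => mem_fst_image_of_depth_pos (ht.trans_le hz)
  have restrict_superlevel {t : ℝ} (ht : 0 < t) :
      (μ.restrict (Prod.fst '' C)).real {z | t ≤ depth C z} = μ.real {z | t ≤ depth C z} := by
    rw [measureReal_restrict_apply (measurableSet_le measurable_const hdepth), superlevel_inter ht]
  have hband := measureReal_univ_div_sixteen_le_of_tail (ν := μ.restrict (Prod.fst '' C)) hdepth
    (fun _ => depth_nonneg) (fun _ => depth_le_one) (fun t ht => ?_)
    (by rwa [measureReal_restrict_apply_univ]) hm (by rwa [measureReal_restrict_apply_univ]) hc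
  · rw [measureReal_restrict_apply_univ] at hband
    refine hband.trans_eq ?_
    change (μ.restrict (Prod.fst '' C)).real (depth C ⁻¹' Icc (m / 4) c) = _
    rw [measureReal_restrict_apply (hdepth measurableSet_Icc), inter_eq_left.mpr fun z hz =>
      mem_fst_image_of_depth_pos ((div_pos hm four_pos).trans_le hz.1)]
  · rw [restrict_superlevel ht, restrict_superlevel (mul_pos two_pos ht),
      measureReal_restrict_apply_univ, Measure.real, Measure.real, Measure.real,
      ← ENNReal.toReal_mul, ← ENNReal.toReal_pow]
    exact ENNReal.toReal_mono
      (ENNReal.pow_ne_top (measure_ne_top_of_subset (inter_eq_left.mp (superlevel_inter ht)) hfin))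
      (hμ.measure_depth_mul_measure_le_sq hC hconv h₀ h₁ ht)

end Depth

section AxialFrame

theorem euclideanHausdorffMeasure_one_real_lineMap_image {E : Type*} [NormedAddCommGroup E]
    [NormedSpace ℝ E] [MeasurableSpace E] [BorelSpace E] (p x : E) (S : Set ℝ) :
    (μHE[1] : Measure E).real (AffineMap.lineMap p x '' S) = dist p x * volume.real S := by
  have hvolume : (μHE[1] : Measure ℝ) = volume := by
    simpa using InnerProductSpace.euclideanHausdorffMeasure_eq_volume (V := ℝ)
  have hlineMap := hausdorffMeasure_lineMap_image p x S
  rw [← Nat.cast_one (R := ℝ)] at hlineMap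
  have himage : (μHE[1] : Measure E) (AffineMap.lineMap p x '' S) = nndist p x • volume S := by
    rw [← hvolume, Measure.euclideanHausdorffMeasure_def, Measure.euclideanHausdorffMeasure_def,
      Measure.smul_apply, Measure.smul_apply, hlineMap, smul_comm]
  rw [Measure.real, himage, ENNReal.smul_def, smul_eq_mul, ENNReal.toReal_mul, ENNReal.coe_toReal,
    coe_nndist, Measure.real]

/-- Orthonormal coordinates on the hyperplane orthogonal to a vector `x ≠ 0`, given as an isometric
embedding of the coordinate space. -/
structure AxialFrame {n : ℕ} (x : EuclideanSpace ℝ (Fin (n + 1))) where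
  incl : EuclideanSpace ℝ (Fin n) →ₗᵢ[ℝ] EuclideanSpace ℝ (Fin (n + 1))
  inner_incl : ∀ z, inner ℝ (incl z) x = 0
  ne_zero : x ≠ 0

theorem nonempty_axialFrame {n : ℕ} {x : EuclideanSpace ℝ (Fin (n + 1))} (hx : x ≠ 0) :
    Nonempty (AxialFrame x) := by
  have : Fact (Module.finrank ℝ (EuclideanSpace ℝ (Fin (n + 1))) = n + 1) := ⟨by simp⟩
  let b := OrthonormalBasis.fromOrthogonalSpanSingleton (𝕜 := ℝ) n hx
  exact ⟨(Submodule.subtypeₗᵢ _).comp b.repr.symm.toLinearIsometry, fun z =>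
    Submodule.mem_orthogonal_singleton_iff_inner_left.mp (b.repr.symm z).2, hx⟩

namespace AxialFrame

variable {n : ℕ} {x : EuclideanSpace ℝ (Fin (n + 1))} (F : AxialFrame x)

theorem inner_incl_add_smul (z : EuclideanSpace ℝ (Fin n)) (t : ℝ) :
    inner ℝ (F.incl z + t • x) x = t * ‖x‖ ^ 2 := by
  rw [inner_add_left, F.inner_incl, real_inner_smul_left, real_inner_self_eq_norm_sq, zero_add]

theorem injective_coprod_incl :
    Function.Injective (F.incl.toLinearMap.coprod (LinearMap.toSpanSingleton ℝ _ x)) := by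
  refine (injective_iff_map_eq_zero _).mpr fun ⟨z, t⟩ h => ?_
  have hx : ‖x‖ ^ 2 ≠ 0 := pow_ne_zero 2 (norm_ne_zero_iff.mpr F.ne_zero)
  replace h : F.incl z + t • x = 0 := h
  have ht : t = 0 := by
    simpa [h, hx] using F.inner_incl_add_smul z t
  rw [ht, zero_smul, add_zero, map_eq_zero_iff _ F.incl.injective] at h
  rw [h, ht, Prod.mk_zero_zero]

/-- The parametrisation `(z, t) ↦ z + t x` of the space by `x^⊥ × ℝ`. -/
noncomputable def toSpace :
    (EuclideanSpace ℝ (Fin n) × ℝ) ≃L[ℝ] EuclideanSpace ℝ (Fin (n + 1)) :=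
  (LinearMap.linearEquivOfInjective _ F.injective_coprod_incl (by simp)).toContinuousLinearEquiv

theorem toSpace_apply (z : EuclideanSpace ℝ (Fin n)) (t : ℝ) :
    F.toSpace (z, t) = F.incl z + t • x :=
  rfl

theorem toSpace_zero_one : F.toSpace (0, 1) = x := by
  rw [toSpace_apply, map_zero, one_smul, zero_add]

theorem toSpace_lineMap_zero_one (p : EuclideanSpace ℝ (Fin n) × ℝ) (s : ℝ) :
    F.toSpace (AffineMap.lineMap p (0, 1) s) = AffineMap.lineMap (F.toSpace p) x s := by
  rw [AffineMap.lineMap_apply_module, AffineMap.lineMap_apply_module, map_add, map_smul, map_smul,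
    toSpace_zero_one]

theorem inner_toSpace (z : EuclideanSpace ℝ (Fin n)) (t : ℝ) :
    inner ℝ (F.toSpace (z, t)) x = t * ‖x‖ ^ 2 :=
  F.inner_incl_add_smul z t

theorem starProjection_toSpace (p : EuclideanSpace ℝ (Fin n) × ℝ) :
    (Submodule.span ℝ {x})ᗮ.starProjection (F.toSpace p) = F.incl p.1 := by
  rw [F.toSpace_apply p.1 p.2, map_add, map_smul,
    Submodule.starProjection_orthogonalComplement_singleton_eq_zero, smul_zero, add_zero,
    Submodule.starProjection_eq_self_iff, Submodule.mem_orthogonal_singleton_iff_inner_left]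
  exact F.inner_incl p.1

theorem norm_fst_le_norm_toSpace (p : EuclideanSpace ℝ (Fin n) × ℝ) :
    ‖p.1‖ ≤ ‖F.toSpace p‖ := by
  rw [← F.incl.norm_map, ← F.starProjection_toSpace]
  exact Submodule.norm_starProjection_apply_le _ _

/-- The set `K` in the coordinates of the frame. -/
def coordSet (K : Set (EuclideanSpace ℝ (Fin (n + 1)))) : Set (EuclideanSpace ℝ (Fin n) × ℝ) :=
  F.toSpace ⁻¹' K

variable {F} {K : Set (EuclideanSpace ℝ (Fin (n + 1)))} {z : EuclideanSpace ℝ (Fin n)}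

theorem isCompact_coordSet (hK : IsCompact K) : IsCompact (F.coordSet K) :=
  F.toSpace.toHomeomorph.isCompact_preimage.mpr hK

theorem convex_coordSet (hK : Convex ℝ K) : Convex ℝ (F.coordSet K) :=
  hK.linear_preimage F.toSpace.toLinearEquiv.toLinearMap

theorem zero_mem_coordSet (h₀ : 0 ∈ K) : (0, 0) ∈ F.coordSet K := by
  rwa [coordSet, mem_preimage, Prod.mk_zero_zero, map_zero]

theorem zero_one_mem_coordSet_iff : (0, 1) ∈ F.coordSet K ↔ x ∈ K := by
  rw [coordSet, mem_preimage, toSpace_zero_one]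

theorem coordSet_frontier : F.coordSet (frontier K) = frontier (F.coordSet K) :=
  F.toSpace.toHomeomorph.preimage_frontier K

theorem shadow_eq_image : shadow x K = F.incl '' (Prod.fst '' F.coordSet K) := by
  rw [coordSet, ← F.toSpace.image_symm_eq_preimage, image_image, image_image, shadow]
  refine image_congr fun y _ => ?_
  rw [← F.starProjection_toSpace, F.toSpace.apply_symm_apply]

theorem euclideanHausdorffMeasure_shadow :
    μHE[n] (shadow x K) = volume (Prod.fst '' F.coordSet K) := by
  rw [shadow_eq_image (F := F), F.incl.isometry.euclideanHausdorffMeasure_image,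
    EuclideanSpace.euclideanHausdorffMeasure_eq_volume]

theorem setIntegral_shadow (φ : EuclideanSpace ℝ (Fin (n + 1)) → ℝ) :
    ∫ y in shadow x K, φ y ∂μHE[n] = ∫ z in Prod.fst '' F.coordSet K, φ (F.incl z) := by
  have hmap := F.incl.isometry.map_euclideanHausdorffMeasure (d := n)
  rw [EuclideanSpace.euclideanHausdorffMeasure_eq_volume] at hmap
  have hset := F.incl.isometry.isClosedEmbedding.measurableEmbedding.setIntegral_map
    (μ := volume) φ (shadow x K)
  rwa [shadow_eq_image (F := F), hmap,
    Measure.restrict_restrict_of_subset (image_subset_range _ _),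
    preimage_image_eq _ F.incl.injective, ← shadow_eq_image] at hset

theorem volume_fst_image_coordSet_le (T : Set (EuclideanSpace ℝ (Fin (n + 1)))) :
    volume (Prod.fst '' F.coordSet T) ≤ μHE[n] T := by
  choose! p hp hpz using fun z (hz : z ∈ Prod.fst '' F.coordSet T) => hz
  rw [← EuclideanSpace.euclideanHausdorffMeasure_eq_volume]
  refine euclideanHausdorffMeasure_le_of_mapsTo_of_dist_le n (f := fun z => F.toSpace (p z))
    hp fun z hz w hw => ?_
  calc dist z w = ‖(p z - p w).1‖ := by rw [Prod.fst_sub, hpz z hz, hpz w hw, dist_eq_norm]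
    _ ≤ ‖F.toSpace (p z - p w)‖ := F.norm_fst_le_norm_toSpace _
    _ = dist (F.toSpace (p z)) (F.toSpace (p w)) := by rw [map_sub, dist_eq_norm]

theorem ball_subset_fst_image_coordSet {c : EuclideanSpace ℝ (Fin (n + 1))} {r : ℝ}
    (h : Metric.ball c r ⊆ K) :
    Metric.ball (F.toSpace.symm c).1 r ⊆ Prod.fst '' F.coordSet K := by
  intro z hz
  refine ⟨F.toSpace.symm c + (z - (F.toSpace.symm c).1, 0), h ?_, add_sub_cancel _ _⟩
  rw [map_add, F.toSpace.apply_symm_apply, toSpace_apply, zero_smul, add_zero, mem_ball_iff_norm,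
    add_sub_cancel_left, F.incl.norm_map]
  exact mem_ball_iff_norm.mp hz

theorem farPoint_incl (hK : IsCompact K) (hz : z ∈ Prod.fst '' F.coordSet K) :
    farPoint K x (F.incl z) = F.toSpace (lowerPoint (F.coordSet K) z) := by
  have hx : 0 < ‖x‖ ^ 2 := pow_pos (norm_pos_iff.mpr F.ne_zero) 2
  have hleast := isLeast_lowerHeight (isCompact_coordSet hK) hz
  have hlower : F.toSpace (lowerPoint (F.coordSet K) z) ∈
      K ∩ range (fun t : ℝ => F.incl z + t • x) := ⟨hleast.1, _, rfl⟩
  have hex : ∃ y, y ∈ K ∩ range (fun t : ℝ => F.incl z + t • x) ∧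
      IsMinOn (fun w => inner ℝ w x) (K ∩ range (fun t : ℝ => F.incl z + t • x)) y := by
    refine ⟨_, hlower, isMinOn_iff.mpr ?_⟩
    rintro _ ⟨hy, t, rfl⟩
    rw [F.inner_incl_add_smul, lowerPoint, F.inner_toSpace]
    exact mul_le_mul_of_nonneg_right (hleast.2 hy) hx.le
  obtain ⟨⟨hmem, t, ht⟩, hmin⟩ := Classical.epsilon_spec hex
  change F.incl z + t • x = farPoint K x (F.incl z) at ht
  have hle := isMinOn_iff.mp hmin _ hlower
  change inner ℝ (farPoint K x (F.incl z)) x ≤ _ at hle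
  change farPoint K x (F.incl z) ∈ K at hmem
  rw [← ht] at hle hmem ⊢
  rw [F.inner_incl_add_smul, lowerPoint, F.inner_toSpace] at hle
  rw [lowerPoint, ← le_antisymm (le_of_mul_le_mul_right hle hx) (hleast.2 hmem), toSpace_apply]

theorem inter_segment_lowerPoint (hK : IsCompact K) (hconv : Convex ℝ K)
    (hz : z ∈ Prod.fst '' F.coordSet K) :
    K ∩ segment ℝ (F.toSpace (lowerPoint (F.coordSet K) z)) x =
      AffineMap.lineMap (F.toSpace (lowerPoint (F.coordSet K) z)) x ''
        Icc 0 (depth (F.coordSet K) z) := by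
  rw [segment_eq_image_lineMap, ← image_preimage_inter]
  congr 1
  ext s
  have mem_iff (hs : s ∈ Icc (0 : ℝ) 1) :
      AffineMap.lineMap (F.toSpace (lowerPoint (F.coordSet K) z)) x s ∈ K ↔
        s ≤ depth (F.coordSet K) z := by
    rw [← F.toSpace_lineMap_zero_one]
    exact (le_depth_iff_lineMap_mem (isCompact_coordSet hK) (convex_coordSet hconv) hz hs).symm
  exact ⟨fun ⟨hmem, hs⟩ => ⟨hs.1, (mem_iff hs).mp hmem⟩, fun hs =>
    ⟨(mem_iff ⟨hs.1, hs.2.trans depth_le_one⟩).mpr hs.2, hs.1, hs.2.trans depth_le_one⟩⟩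

theorem depthRatio_incl (hK : IsCompact K) (hconv : Convex ℝ K) (h₀ : 0 ∈ K)
    (hz : z ∈ Prod.fst '' F.coordSet K) :
    depthRatio K x (F.incl z) = depth (F.coordSet K) z := by
  have hne : F.toSpace (lowerPoint (F.coordSet K) z) ≠ x := fun h =>
    lowerPoint_ne_zero_one (isCompact_coordSet hK) (zero_mem_coordSet h₀)
      (F.toSpace.injective (h.trans F.toSpace_zero_one.symm))
  rw [depthRatio, farPoint_incl hK hz, segment_symm, inter_segment_lowerPoint hK hconv hz,
    segment_eq_image_lineMap, euclideanHausdorffMeasure_one_real_lineMap_image,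
    euclideanHausdorffMeasure_one_real_lineMap_image, Real.volume_real_Icc_of_le depth_nonneg,
    Real.volume_real_Icc_of_le zero_le_one, mul_div_mul_left _ _ (dist_ne_zero.mpr hne), sub_zero,
    sub_zero, div_one]

theorem measurableSet_fst_image_coordSet (hK : IsCompact K) :
    MeasurableSet (Prod.fst '' F.coordSet K) :=
  ((isCompact_coordSet hK).image continuous_fst).measurableSet

theorem volume_real_fst_image_coordSet_pos (hK : IsConvexBody K) :
    0 < volume.real (Prod.fst '' F.coordSet K) := by
  obtain ⟨c, hc⟩ := hK.interior_nonempty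
  obtain ⟨r, hr, hball⟩ := Metric.isOpen_iff.mp isOpen_interior c hc
  have hpos : 0 < volume (Prod.fst '' F.coordSet K) :=
    (Metric.measure_ball_pos volume (F.toSpace.symm c).1 hr).trans_le
      (measure_mono (ball_subset_fst_image_coordSet (hball.trans interior_subset)))
  exact ENNReal.toReal_pos hpos.ne'
    ((isCompact_coordSet hK.isCompact).image continuous_fst).measure_ne_top

theorem euclideanHausdorffMeasure_real_shadow :
    (μHE[n] : Measure (EuclideanSpace ℝ (Fin (n + 1)))).real (shadow x K) =
      volume.real (Prod.fst '' F.coordSet K) :=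
  congrArg ENNReal.toReal euclideanHausdorffMeasure_shadow

theorem setIntegral_depth (hK : IsConvexBody K) (h₀ : 0 ∈ K) :
    ∫ z in Prod.fst '' F.coordSet K, depth (F.coordSet K) z =
      avgDepthRatio K x * volume.real (Prod.fst '' F.coordSet K) := by
  rw [avgDepthRatio, Nat.add_sub_cancel, euclideanHausdorffMeasure_real_shadow (F := F),
    setIntegral_shadow (F := F), mul_right_comm,
    inv_mul_cancel₀ (volume_real_fst_image_coordSet_pos hK).ne', one_mul]
  exact setIntegral_congr_fun (measurableSet_fst_image_coordSet hK.isCompact) fun z hz =>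
    (depthRatio_incl hK.isCompact hK.convex h₀ hz).symm

theorem measurable_toSpace_lowerPoint (hK : IsCompact K) :
    Measurable fun z => F.toSpace (lowerPoint (F.coordSet K) z) :=
  F.toSpace.continuous.measurable.comp
    (measurable_id.prodMk (measurable_lowerHeight (isCompact_coordSet hK)))

theorem measurable_toSpace_exitPoint (hK : IsCompact K) (hconv : Convex ℝ K) (h₀ : 0 ∈ K) :
    Measurable fun z => F.toSpace (exitPoint (F.coordSet K) z) := by
  have hdepth := measurable_depth (isCompact_coordSet (F := F) hK) (convex_coordSet hconv)
    (zero_mem_coordSet h₀)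
  simp only [exitPoint, AffineMap.lineMap_apply_module, map_add, map_smul]
  exact ((measurable_const.sub hdepth).smul (measurable_toSpace_lowerPoint hK)).add
    (hdepth.smul_const _)

theorem map_toSpace_lowerPoint_le (hK : IsCompact K) {A : Set (EuclideanSpace ℝ (Fin n))}
    (hA : A ⊆ Prod.fst '' F.coordSet K) :
    (volume.restrict A).map (fun z => F.toSpace (lowerPoint (F.coordSet K) z)) ≤
      μHE[n].restrict (frontier K) := by
  refine Measure.le_iff.mpr fun T hT => ?_
  have hγ := measurable_toSpace_lowerPoint (F := F) hK
  rw [Measure.map_apply hγ hT, Measure.restrict_apply (hγ hT), Measure.restrict_apply hT]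
  refine (measure_mono fun z hz => ?_).trans (F.volume_fst_image_coordSet_le (T ∩ frontier K))
  have hfrontier : lowerPoint (F.coordSet K) z ∈ F.coordSet (frontier K) :=
    coordSet_frontier ▸ lowerPoint_mem_frontier (isCompact_coordSet hK) (hA hz.2)
  exact ⟨lowerPoint (F.coordSet K) z, ⟨hz.1, hfrontier⟩, rfl⟩

theorem map_toSpace_exitPoint_le (hK : IsCompact K) (hconv : Convex ℝ K) (h₀ : 0 ∈ K)
    (hxK : x ∉ K) {A : Set (EuclideanSpace ℝ (Fin n))} (hA : MeasurableSet A)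
    (hAK : A ⊆ Prod.fst '' F.coordSet K) {c : ℝ} (hc : c < 1)
    (hAc : ∀ z ∈ A, depth (F.coordSet K) z ≤ c) :
    (volume.restrict A).map (fun z => F.toSpace (exitPoint (F.coordSet K) z)) ≤
      ENNReal.ofReal ((1 - c)⁻¹ ^ (n + 1)) • μHE[n].restrict (frontier K) := by
  have hC := isCompact_coordSet (F := F) hK
  have hCconv := convex_coordSet (F := F) hconv
  have h₁ := zero_one_mem_coordSet_iff (F := F).not.mpr hxK
  refine Measure.le_iff.mpr fun T hT => ?_
  have hγ := measurable_toSpace_exitPoint (F := F) hK hconv h₀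
  rw [Measure.map_apply hγ hT, Measure.restrict_apply (hγ hT), Measure.smul_apply,
    Measure.restrict_apply hT, smul_eq_mul]
  have hcontract := measure_le_measure_image_exitPoint volume hC hCconv (zero_mem_coordSet h₀) h₁
    ((hγ hT).inter hA) (inter_subset_right.trans hAK) hc fun z hz => hAc z hz.2
  rw [finrank_euclideanSpace_fin] at hcontract
  refine hcontract.trans (mul_le_mul_right ?_ _)
  refine (measure_mono ?_).trans (F.volume_fst_image_coordSet_le (T ∩ frontier K))
  rintro _ ⟨z, hz, rfl⟩
  have hfrontier : exitPoint (F.coordSet K) z ∈ F.coordSet (frontier K) :=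
    coordSet_frontier ▸ exitPoint_mem_frontier hC hCconv h₁ (hAK hz.2)
  exact mem_image_of_mem Prod.fst ⟨hz.1, hfrontier⟩

end AxialFrame

theorem avgDepthRatio_of_mem {n : ℕ} {K : Set (EuclideanSpace ℝ (Fin (n + 1)))}
    (hK : IsConvexBody K) (h₀ : 0 ∈ K) {x : EuclideanSpace ℝ (Fin (n + 1))} (hx : x ≠ 0)
    (hxK : x ∈ K) : avgDepthRatio K x = 1 := by
  obtain ⟨F⟩ := nonempty_axialFrame hx
  have hC := AxialFrame.isCompact_coordSet (F := F) hK.isCompact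
  have depth_eq_one : ∀ z ∈ Prod.fst '' F.coordSet K, depth (F.coordSet K) z = 1 := fun z hz =>
    depth_le_one.antisymm <| (le_depth_iff_lineMap_mem hC (AxialFrame.convex_coordSet hK.convex) hz
      (right_mem_Icc.mpr zero_le_one)).mpr <| by
        rwa [AffineMap.lineMap_apply_one, AxialFrame.zero_one_mem_coordSet_iff]
  have hmean := AxialFrame.setIntegral_depth (F := F) hK h₀
  rw [setIntegral_congr_fun (AxialFrame.measurableSet_fst_image_coordSet hK.isCompact)
    depth_eq_one, setIntegral_const, smul_eq_mul, mul_one] at hmean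
  exact (right_eq_mul₀ (AxialFrame.volume_real_fst_image_coordSet_pos hK).ne').mp hmean

theorem avgDepthRatio_zero {n : ℕ} {K : Set (EuclideanSpace ℝ (Fin (n + 1)))}
    (hK : (interior K).Nonempty) : avgDepthRatio K 0 = 0 := by
  have hshadow : shadow 0 K = K := by
    simp only [shadow, Submodule.span_zero_singleton, Submodule.bot_orthogonal_eq_top,
      Submodule.starProjection_top, ContinuousLinearMap.id_apply, image_id']
  have htop : (μHE[n] : Measure (EuclideanSpace ℝ (Fin (n + 1)))) K = ⊤ := by
    refine (Measure.euclideanHausdorffMeasure_zero_or_top n.lt_succ_self K).resolve_left ?_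
    rw [EuclideanSpace.euclideanHausdorffMeasure_eq_volume]
    exact (Measure.measure_pos_of_nonempty_interior volume hK).ne'
  rw [avgDepthRatio, hshadow, Nat.add_sub_cancel, Measure.real, htop, ENNReal.toReal_top,
    inv_zero, zero_mul]

end AxialFrame

section SurfaceArea

theorem dist_le_dist_of_inner_nonpos {E : Type*} [NormedAddCommGroup E] [InnerProductSpace ℝ E]
    {y z p q : E} (hp : inner ℝ (p - y) (z - y) ≤ 0) (hq : inner ℝ (q - z) (y - z) ≤ 0) :
    dist y z ≤ dist p q := by
  rw [dist_eq_norm, dist_eq_norm]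
  have hinner : ‖y - z‖ * ‖y - z‖ ≤ inner ℝ (p - q) (y - z) := by
    rw [← real_inner_self_eq_norm_mul_norm]
    simp only [inner_sub_left, inner_sub_right] at *
    linarith
  rcases (norm_nonneg (y - z)).eq_or_lt with h | h
  · exact h ▸ norm_nonneg _
  · exact le_of_mul_le_mul_right (hinner.trans (real_inner_le_norm _ _)) h

theorem exists_outward_normal {E : Type*} [NormedAddCommGroup E] [InnerProductSpace ℝ E]
    [CompleteSpace E] {K : Set E} (hconv : Convex ℝ K) (hint : (interior K).Nonempty) {y : E}
    (hy : y ∉ interior K) : ∃ u ≠ 0, ∀ w ∈ K, inner ℝ u (w - y) ≤ 0 := by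
  obtain ⟨l, hl, hmax⟩ := geometric_hahn_banach_of_nonempty_interior_point hconv hy hint
  refine ⟨(InnerProductSpace.toDual ℝ E).symm l,
    (map_eq_zero_iff _ (InnerProductSpace.toDual ℝ E).symm.injective).not.mpr hl, fun w hw => ?_⟩
  rw [InnerProductSpace.toDual_symm_apply, map_sub, sub_nonpos]
  exact hmax w hw

theorem exists_nonneg_norm_add_smul_eq {E : Type*} [NormedAddCommGroup E] [NormedSpace ℝ E]
    {y u : E} (hu : u ≠ 0) {R : ℝ} (hR : ‖y‖ ≤ R) : ∃ s : ℝ, 0 ≤ s ∧ ‖y + s • u‖ = R := by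
  set b := (R + ‖y‖) / ‖u‖ with hb
  have hb₀ : 0 ≤ b := div_nonneg (by linarith [norm_nonneg y]) (norm_nonneg u)
  have hend : R ≤ ‖y + b • u‖ := by
    have htriangle := norm_sub_norm_le (b • u) (-y)
    rw [sub_neg_eq_add, add_comm, norm_neg, norm_smul, Real.norm_of_nonneg hb₀, hb,
      div_mul_cancel₀ _ (norm_ne_zero_iff.mpr hu)] at htriangle
    linarith
  have hcont : Continuous fun s : ℝ => ‖y + s • u‖ := by fun_prop
  obtain ⟨s, hs, hsR⟩ := intermediate_value_Icc hb₀ hcont.continuousOn ⟨by simpa using hR, hend⟩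
  exact ⟨s, hs.1, hsR⟩

variable {n : ℕ} {K : Set (EuclideanSpace ℝ (Fin (n + 1)))}

theorem euclideanHausdorffMeasure_cube_face_lt_top (i : Fin (n + 1)) (c R : ℝ) :
    μHE[n] {p : EuclideanSpace ℝ (Fin (n + 1)) | p i = c ∧ ‖p.ofLp‖ ≤ R} < ⊤ := by
  let B : Set (EuclideanSpace ℝ (Fin n)) := WithLp.ofLp ⁻¹' Metric.closedBall 0 R
  have hB : μHE[n] B < ⊤ := by
    rw [EuclideanSpace.euclideanHausdorffMeasure_eq_volume,
      (PiLp.volume_preserving_ofLp (Fin n)).measure_preimage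
        Metric.isClosed_closedBall.nullMeasurableSet]
    exact measure_closedBall_lt_top
  refine (euclideanHausdorffMeasure_le_of_mapsTo_of_dist_le n
    (f := fun p => WithLp.toLp 2 (i.removeNth p.ofLp)) (fun p hp => ?_)
    fun p hp q hq => ?_).trans_lt hB
  · refine mem_closedBall_zero_iff.mpr ((pi_norm_le_iff_of_nonneg ?_).mpr fun j => ?_)
    · exact (norm_nonneg _).trans hp.2
    · exact (norm_le_pi_norm p.ofLp _).trans hp.2
  · rw [EuclideanSpace.dist_eq, EuclideanSpace.dist_eq, Fin.sum_univ_succAbove _ i, hp.1, hq.1,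
      dist_self, sq, zero_mul, zero_add]
    rfl

theorem euclideanHausdorffMeasure_cube_boundary_lt_top (R : ℝ) :
    μHE[n] {p : EuclideanSpace ℝ (Fin (n + 1)) | ‖p.ofLp‖ = R} < ⊤ := by
  have cover : {p : EuclideanSpace ℝ (Fin (n + 1)) | ‖p.ofLp‖ = R} ⊆
      ⋃ i, {p | p i = R ∧ ‖p.ofLp‖ ≤ R} ∪ {p | p i = -R ∧ ‖p.ofLp‖ ≤ R} := by
    intro p (hp : ‖p.ofLp‖ = R)
    obtain ⟨i, -, hi⟩ :=
      Finset.exists_mem_eq_sup' Finset.univ_nonempty fun i => ‖p.ofLp i‖₊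
    have hnorm : |p i| = R := by
      rw [← hp, Pi.norm_def, ← Finset.sup'_eq_sup Finset.univ_nonempty, hi]
      rfl
    refine mem_iUnion.mpr ⟨i, ?_⟩
    rcases eq_or_eq_neg_of_abs_eq hnorm with h | h
    · exact .inl ⟨h, hp.le⟩
    · exact .inr ⟨h, hp.le⟩
  refine (measure_mono cover).trans_lt ((measure_iUnion_fintype_le _ _).trans_lt ?_)
  exact ENNReal.sum_lt_top.mpr fun i _ => (measure_union_le _ _).trans_lt
    (ENNReal.add_lt_top.mpr ⟨euclideanHausdorffMeasure_cube_face_lt_top i R R,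
      euclideanHausdorffMeasure_cube_face_lt_top i (-R) R⟩)

/-- Moving each boundary point along an outward normal to the boundary of a large cube does not
decrease distances. -/
theorem euclideanHausdorffMeasure_frontier_lt_top (hK : IsConvexBody K) :
    μHE[n] (frontier K) < ⊤ := by
  have hofLp : Continuous fun p : EuclideanSpace ℝ (Fin (n + 1)) => ‖p.ofLp‖ := by fun_prop
  obtain ⟨R, hR⟩ := (hK.isCompact.image hofLp).bddAbove
  have hfrontier : frontier K ⊆ K := hK.isCompact.isClosed.frontier_subset
  have exists_normal_mem_cube : ∀ y ∈ frontier K, ∃ p : EuclideanSpace ℝ (Fin (n + 1)),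
      ‖p.ofLp‖ = R ∧ ∀ w ∈ K, inner ℝ (p - y) (w - y) ≤ 0 := by
    intro y hy
    obtain ⟨u, hu, hnormal⟩ := exists_outward_normal hK.convex hK.interior_nonempty hy.2
    obtain ⟨s, hs, hsR⟩ := exists_nonneg_norm_add_smul_eq
      ((WithLp.ofLp_eq_zero 2).not.mpr hu) (hR (mem_image_of_mem _ (hfrontier hy)))
    refine ⟨y + s • u, hsR, fun w hw => ?_⟩
    rw [add_sub_cancel_left, real_inner_smul_left]
    exact mul_nonpos_of_nonneg_of_nonpos hs (hnormal w hw)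
  choose! p hpR hp using exists_normal_mem_cube
  refine (euclideanHausdorffMeasure_le_of_mapsTo_of_dist_le n (fun y hy => hpR y hy)
    fun y hy z hz => ?_).trans_lt (euclideanHausdorffMeasure_cube_boundary_lt_top R)
  exact dist_le_dist_of_inner_nonpos (hp y hy z (hfrontier hz)) (hp z hz y (hfrontier hy))

theorem euclideanHausdorffMeasure_frontier_ne_zero (hK : IsConvexBody K) :
    μHE[n] (frontier K) ≠ 0 := by
  obtain ⟨F⟩ := nonempty_axialFrame
    (x := EuclideanSpace.single (0 : Fin (n + 1)) (1 : ℝ)) (by simp)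
  have hpos : 0 < volume (Prod.fst '' F.coordSet K) :=
    (ENNReal.toReal_pos_iff.mp (AxialFrame.volume_real_fst_image_coordSet_pos hK)).1
  refine (hpos.trans_le ((measure_mono fun z hz => ?_).trans
    (F.volume_fst_image_coordSet_le (frontier K)))).ne'
  rw [AxialFrame.coordSet_frontier]
  exact ⟨_, lowerPoint_mem_frontier (AxialFrame.isCompact_coordSet hK.isCompact) hz, rfl⟩

theorem isProbabilityMeasure_surfaceProb (hK : IsConvexBody K) :
    IsProbabilityMeasure (surfaceProb K) := by
  refine ⟨?_⟩
  rw [surfaceProb, Measure.smul_apply, Measure.restrict_apply_univ, smul_eq_mul]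
  exact ENNReal.inv_mul_cancel (euclideanHausdorffMeasure_frontier_ne_zero hK)
    (euclideanHausdorffMeasure_frontier_lt_top hK).ne

theorem ae_surfaceProb_mem (hK : IsClosed K) : ∀ᵐ y ∂surfaceProb K, y ∈ K :=
  Measure.ae_smul_measure ((ae_restrict_mem isClosed_frontier.measurableSet).mono
    fun _ hy => hK.frontier_subset hy) _

theorem integrable_surfaceProb_iff (hK : IsConvexBody K)
    {φ : EuclideanSpace ℝ (Fin (n + 1)) → ℝ} :
    Integrable φ (surfaceProb K) ↔ IntegrableOn φ (frontier K) μHE[n] :=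
  integrable_smul_measure
    (ENNReal.inv_ne_zero.mpr (euclideanHausdorffMeasure_frontier_lt_top hK).ne)
    (ENNReal.inv_ne_top.mpr (euclideanHausdorffMeasure_frontier_ne_zero hK))

theorem setIntegral_frontier (hK : IsConvexBody K) (φ : EuclideanSpace ℝ (Fin (n + 1)) → ℝ) :
    ∫ y in frontier K, φ y ∂μHE[n] =
      (μHE[n] : Measure (EuclideanSpace ℝ (Fin (n + 1)))).real (frontier K) *
        ∫ y, φ y ∂surfaceProb K := by
  have hne : (μHE[n] : Measure (EuclideanSpace ℝ (Fin (n + 1)))).real (frontier K) ≠ 0 :=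
    ENNReal.toReal_ne_zero.mpr ⟨euclideanHausdorffMeasure_frontier_ne_zero hK,
      (euclideanHausdorffMeasure_frontier_lt_top hK).ne⟩
  rw [surfaceProb, integral_smul_measure, ENNReal.toReal_inv, smul_eq_mul]
  exact (mul_inv_cancel_left₀ hne _).symm

theorem shadow_smul {d : ℕ} {c : ℝ} (hc : c ≠ 0) (x : EuclideanSpace ℝ (Fin d))
    (K : Set (EuclideanSpace ℝ (Fin d))) : shadow (c • x) K = shadow x K := by
  simp only [shadow, Submodule.span_singleton_smul_eq (IsUnit.mk0 c hc) x]

theorem surface_div_shadow_le_max (hK : IsConvexBody K) {x : EuclideanSpace ℝ (Fin (n + 1))}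
    (hx : x ≠ 0) :
    (μHE[n] : Measure (EuclideanSpace ℝ (Fin (n + 1)))).real (frontier K) /
      (μHE[n] : Measure (EuclideanSpace ℝ (Fin (n + 1)))).real (shadow x K) ≤
        maxSurfaceShadowRatio K := by
  obtain ⟨c, hc⟩ := hK.interior_nonempty
  obtain ⟨r, hr, hball⟩ := Metric.isOpen_iff.mp isOpen_interior c hc
  have hpos : 0 < volume.real (Metric.ball (0 : EuclideanSpace ℝ (Fin n)) r) :=
    ENNReal.toReal_pos (Metric.measure_ball_pos _ _ hr).ne' measure_ball_lt_top.ne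
  have ball_le_shadow {θ : EuclideanSpace ℝ (Fin (n + 1))} (hθ : θ ≠ 0) :
      volume.real (Metric.ball (0 : EuclideanSpace ℝ (Fin n)) r) ≤
        (μHE[n] : Measure (EuclideanSpace ℝ (Fin (n + 1)))).real (shadow θ K) := by
    obtain ⟨F⟩ := nonempty_axialFrame hθ
    rw [AxialFrame.euclideanHausdorffMeasure_real_shadow (F := F), Measure.real,
      ← Measure.addHaar_ball_center volume (F.toSpace.symm c).1]
    exact measureReal_mono
      (AxialFrame.ball_subset_fst_image_coordSet (hball.trans interior_subset))
      ((AxialFrame.isCompact_coordSet hK.isCompact).image continuous_fst).measure_ne_top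
  have hbdd : BddAbove (range fun θ : Metric.sphere (0 : EuclideanSpace ℝ (Fin (n + 1))) 1 =>
      (μHE[n] : Measure (EuclideanSpace ℝ (Fin (n + 1)))).real (frontier K) /
        (μHE[n] : Measure (EuclideanSpace ℝ (Fin (n + 1)))).real (shadow (θ : _) K)) := by
    refine ⟨(μHE[n] : Measure (EuclideanSpace ℝ (Fin (n + 1)))).real (frontier K) /
      volume.real (Metric.ball (0 : EuclideanSpace ℝ (Fin n)) r), forall_mem_range.mpr fun θ => ?_⟩
    exact div_le_div_of_nonneg_left measureReal_nonneg hpos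
      (ball_le_shadow (ne_zero_of_mem_unit_sphere θ))
  rw [← shadow_smul (inv_ne_zero (norm_ne_zero_iff.mpr hx))]
  refine le_ciSup hbdd ⟨‖x‖⁻¹ • x, ?_⟩
  rw [mem_sphere_zero_iff_norm, norm_smul, norm_inv, norm_norm,
    inv_mul_cancel₀ (norm_ne_zero_iff.mpr hx)]

end SurfaceArea

section LevelSet

theorem tendsto_lineMap_nhdsGT_zero (a b : ℝ) :
    Tendsto (fun t : ℝ => (1 - t) * a + t * b) (nhdsWithin 0 (Ioi 0)) (nhds a) := by
  have hcont : Continuous fun t : ℝ => (1 - t) * a + t * b := by fun_prop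
  simpa using (hcont.tendsto 0).mono_left nhdsWithin_le_nhds

theorem le_of_forall_le_lineMap {E : Type*} [AddCommGroup E] [Module ℝ E] {D : Set E} {g : E → ℝ}
    (hg : ConvexOn ℝ D g) {q x : E} (hq : q ∈ D) (hx : x ∈ D) {G : ℝ}
    (h : ∀ t ∈ Ioc (0 : ℝ) 1, G ≤ g (AffineMap.lineMap q x t)) : G ≤ g q := by
  refine ge_of_tendsto (tendsto_lineMap_nhdsGT_zero (g q) (g x)) ?_
  filter_upwards [Ioc_mem_nhdsGT one_pos] with t ht
  refine (h t ht).trans ?_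
  rw [AffineMap.lineMap_apply_module]
  exact hg.2 hq hx (sub_nonneg.mpr ht.2) ht.1.le (sub_add_cancel 1 t)

theorem nonempty_interior_sublevel {E : Type*} [NormedAddCommGroup E] [NormedSpace ℝ E]
    [FiniteDimensional ℝ E] {D : Set E} {g : E → ℝ} (hg : ConvexOn ℝ D g)
    (hD : (interior D).Nonempty) {x : E} (hx : x ∈ D) {G : ℝ} (hxG : g x < G) :
    (interior {y | y ∈ D ∧ g y ≤ G}).Nonempty := by
  obtain ⟨c, hc⟩ := hD
  obtain ⟨t, htG, ht₀, ht₁⟩ := (((tendsto_lineMap_nhdsGT_zero (g x) (g c)).eventually_lt_const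
    hxG).and (Ioo_mem_nhdsGT one_pos)).exists
  have hmem : (1 - t) • x + t • c ∈ interior D :=
    hg.1.combo_self_interior_mem_interior hx hc (sub_nonneg.mpr ht₁.le) ht₀ (sub_add_cancel 1 t)
  have hlt : g ((1 - t) • x + t • c) < G :=
    (hg.2 hx (interior_subset hc) (sub_nonneg.mpr ht₁.le) ht₀.le (sub_add_cancel 1 t)).trans_lt htG
  have hcont := hg.continuousOn_interior.continuousAt (isOpen_interior.mem_nhds hmem)
  refine ⟨(1 - t) • x + t • c, mem_interior_iff_mem_nhds.mpr ?_⟩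
  filter_upwards [isOpen_interior.mem_nhds hmem, hcont.eventually_lt_const hlt] with y hy hyG
  exact ⟨interior_subset hy, hyG.le⟩

variable {d : ℕ} {D : Set (EuclideanSpace ℝ (Fin d))}

theorem isConvexBody_levelSet (hD : IsConvexBody D) {g : EuclideanSpace ℝ (Fin d) → ℝ}
    (hg : ConvexOn ℝ D g) {ε : ℝ} (hε : 0 < ε) (hclosed : IsClosed (levelSet D g ε)) :
    IsConvexBody (levelSet D g ε) := by
  have hne : (g '' D).Nonempty := (hD.interior_nonempty.mono interior_subset).image g
  obtain ⟨_, ⟨x, hx, rfl⟩, hlt⟩ := exists_lt_of_csInf_lt hne (lt_add_of_pos_right _ hε)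
  exact ⟨hg.convex_le _, hD.isCompact.of_isClosed_subset hclosed fun y hy => hy.1,
    nonempty_interior_sublevel hg hD.interior_nonempty hx hlt⟩

theorem infOn_eq_of_isMinOn {f : EuclideanSpace ℝ (Fin d) → ℝ} {x : EuclideanSpace ℝ (Fin d)}
    (hx : x ∈ D) (hmin : IsMinOn f D x) : infOn D f = f x :=
  IsLeast.csInf_eq ⟨mem_image_of_mem f hx, forall_mem_image.mpr fun _ hy => hmin hy⟩

end LevelSet

section Gap

theorem integrable_comp_of_map_le {α β : Type*} [MeasurableSpace α] [MeasurableSpace β]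
    {μ : Measure α} {ν : Measure β} {γ : α → β} (hγ : Measurable γ) {c : ℝ≥0∞} (hc : c ≠ ∞)
    (hle : μ.map γ ≤ c • ν) {φ : β → ℝ} (hφ : Integrable φ ν) :
    Integrable (fun a => φ (γ a)) μ :=
  ((hφ.smul_measure hc).mono_measure hle).comp_measurable hγ

theorem integral_comp_le_of_map_le {α β : Type*} [MeasurableSpace α] [MeasurableSpace β]
    {μ : Measure α} {ν : Measure β} {γ : α → β} (hγ : Measurable γ) {c : ℝ≥0∞} (hc : c ≠ ∞)
    (hle : μ.map γ ≤ c • ν) {φ : β → ℝ} (hφ : Integrable φ ν) (hφ₀ : 0 ≤ φ) :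
    ∫ a, φ (γ a) ∂μ ≤ c.toReal * ∫ b, φ b ∂ν := by
  have hφc : Integrable φ (c • ν) := hφ.smul_measure hc
  rw [← smul_eq_mul, ← integral_smul_measure,
    ← integral_map hγ.aemeasurable (hφc.mono_measure hle).aestronglyMeasurable]
  exact integral_mono_measure hle (ae_of_all _ hφ₀) hφc

theorem mul_sub_le_abs_sub_add_abs_sub {E : Type*} [AddCommGroup E] [Module ℝ E] {D : Set E}
    {f g : E → ℝ} (hf : ConvexOn ℝ D f) {p x : E} (hp : p ∈ D) (hx : x ∈ D) {G s : ℝ}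
    (hs : s ∈ Icc (0 : ℝ) 1) (hpG : g p ≤ G) (hqG : G ≤ g (AffineMap.lineMap p x s)) :
    s * (G - f x) ≤
      |f (AffineMap.lineMap p x s) - g (AffineMap.lineMap p x s)| + |f p - g p| := by
  have hconvex := hf.2 hp hx (sub_nonneg.mpr hs.2) hs.1 (sub_add_cancel 1 s)
  rw [← AffineMap.lineMap_apply_module, smul_eq_mul, smul_eq_mul] at hconvex
  set q := AffineMap.lineMap p x s
  have hfp : (1 - s) * f p ≤ (1 - s) * G + |f p - g p| := by
    calc (1 - s) * f p ≤ (1 - s) * (G + |f p - g p|) :=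
          mul_le_mul_of_nonneg_left (by linarith [le_abs_self (f p - g p)]) (sub_nonneg.mpr hs.2)
      _ ≤ (1 - s) * G + |f p - g p| := by
          nlinarith [mul_nonneg hs.1 (abs_nonneg (f p - g p))]
  linarith [neg_abs_le (f q - g q)]

variable {n : ℕ} {D K : Set (EuclideanSpace ℝ (Fin (n + 1)))}
  {f g : EuclideanSpace ℝ (Fin (n + 1)) → ℝ} {G : ℝ} {x : EuclideanSpace ℝ (Fin (n + 1))}

namespace AxialFrame

variable {F : AxialFrame x} {z : EuclideanSpace ℝ (Fin n)}

theorem le_apply_exitPoint (hg : ConvexOn ℝ D g) (hK : IsConvexBody K)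
    (hKG : ∀ y, y ∈ K ↔ y ∈ D ∧ g y ≤ G) (hx : x ∈ D) (hxK : x ∉ K)
    (hz : z ∈ Prod.fst '' F.coordSet K) : G ≤ g (F.toSpace (exitPoint (F.coordSet K) z)) := by
  have hC := isCompact_coordSet (F := F) hK.isCompact
  have hlower : F.toSpace (lowerPoint (F.coordSet K) z) ∈ D :=
    ((hKG _).mp (lowerPoint_mem hC hz)).1
  rw [exitPoint, F.toSpace_lineMap_zero_one]
  refine le_of_forall_le_lineMap hg
    (hg.1.lineMap_mem hlower hx ⟨depth_nonneg, depth_le_one⟩) hx fun t ht => ?_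
  rw [AffineMap.lineMap_lineMap_left]
  set u := 1 - (1 - t) * (1 - depth (F.coordSet K) z)
  have hdepth : 0 < 1 - depth (F.coordSet K) z :=
    sub_pos.mpr (depth_lt_one hC (zero_one_mem_coordSet_iff.not.mpr hxK))
  have depth_lt : depth (F.coordSet K) z < u :=
    lt_sub_comm.mp (mul_lt_of_lt_one_left hdepth (sub_lt_self 1 ht.1))
  have hu : u ∈ Icc (0 : ℝ) 1 :=
    ⟨depth_nonneg.trans depth_lt.le, sub_le_self 1 (mul_nonneg (sub_nonneg.mpr ht.2) hdepth.le)⟩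
  by_contra! hlt
  have hmem : AffineMap.lineMap (F.toSpace (lowerPoint (F.coordSet K) z)) x u ∈ K :=
    (hKG _).mpr ⟨hg.1.lineMap_mem hlower hx hu, hlt.le⟩
  rw [← F.toSpace_lineMap_zero_one] at hmem
  exact depth_lt.not_ge ((le_depth_iff_lineMap_mem hC (convex_coordSet hK.convex) hz hu).mpr hmem)

theorem sq_depth_mul_sub_le (hf : ConvexOn ℝ D f) (hg : ConvexOn ℝ D g) (hK : IsConvexBody K)
    (hKG : ∀ y, y ∈ K ↔ y ∈ D ∧ g y ≤ G) (hx : x ∈ D) (hxK : x ∉ K) (hgap : f x ≤ G)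
    (hz : z ∈ Prod.fst '' F.coordSet K) :
    (depth (F.coordSet K) z * (G - f x)) ^ 2 ≤
      2 * ((f (F.toSpace (exitPoint (F.coordSet K) z)) -
          g (F.toSpace (exitPoint (F.coordSet K) z))) ^ 2 +
        (f (F.toSpace (lowerPoint (F.coordSet K) z)) -
          g (F.toSpace (lowerPoint (F.coordSet K) z))) ^ 2) := by
  have hexit := le_apply_exitPoint hg hK hKG hx hxK hz
  obtain ⟨hlowerD, hlowerG⟩ :=
    (hKG _).mp (lowerPoint_mem (isCompact_coordSet (F := F) hK.isCompact) hz)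
  rw [exitPoint, F.toSpace_lineMap_zero_one] at hexit ⊢
  have hle := mul_sub_le_abs_sub_add_abs_sub hf hlowerD hx ⟨depth_nonneg, depth_le_one⟩ hlowerG
    hexit
  have hsq := (pow_le_pow_left₀ (mul_nonneg depth_nonneg (sub_nonneg.mpr hgap)) hle 2).trans
    add_sq_le
  rwa [sq_abs, sq_abs] at hsq

theorem integral_exitPoint_add_lowerPoint_le (hK : IsConvexBody K) (h₀ : 0 ∈ K) (hxK : x ∉ K)
    {A : Set (EuclideanSpace ℝ (Fin n))} (hA : MeasurableSet A)
    (hAK : A ⊆ Prod.fst '' F.coordSet K) {c : ℝ} (hc : c < 1)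
    (hAc : ∀ z ∈ A, depth (F.coordSet K) z ≤ c) {φ : EuclideanSpace ℝ (Fin (n + 1)) → ℝ}
    (hφ : IntegrableOn φ (frontier K) μHE[n]) (hφ₀ : 0 ≤ φ) :
    IntegrableOn (fun z => φ (F.toSpace (exitPoint (F.coordSet K) z)) +
        φ (F.toSpace (lowerPoint (F.coordSet K) z))) A ∧
      ∫ z in A, (φ (F.toSpace (exitPoint (F.coordSet K) z)) +
        φ (F.toSpace (lowerPoint (F.coordSet K) z))) ≤
          ((1 - c)⁻¹ ^ (n + 1) + 1) * ∫ y in frontier K, φ y ∂μHE[n] := by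
  have hexit := measurable_toSpace_exitPoint (F := F) hK.isCompact hK.convex h₀
  have hlower := measurable_toSpace_lowerPoint (F := F) hK.isCompact
  have map_exit_le := map_toSpace_exitPoint_le hK.isCompact hK.convex h₀ hxK hA hAK hc hAc
  have map_lower_le : _ ≤ (1 : ℝ≥0∞) • μHE[n].restrict (frontier K) :=
    (map_toSpace_lowerPoint_le hK.isCompact hAK).trans_eq (one_smul _ _).symm
  have hexit_int := integrable_comp_of_map_le hexit ENNReal.ofReal_ne_top map_exit_le hφ
  have hlower_int := integrable_comp_of_map_le hlower ENNReal.one_ne_top map_lower_le hφ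
  refine ⟨hexit_int.add hlower_int, ?_⟩
  rw [integral_add hexit_int hlower_int, add_mul]
  refine add_le_add ?_ ?_
  · rw [← ENNReal.toReal_ofReal (pow_nonneg (inv_nonneg.mpr (sub_nonneg.mpr hc.le)) (n + 1))]
    exact integral_comp_le_of_map_le hexit ENNReal.ofReal_ne_top map_exit_le hφ hφ₀
  · rw [← ENNReal.toReal_one]
    exact integral_comp_le_of_map_le hlower ENNReal.one_ne_top map_lower_le hφ hφ₀

theorem sq_mul_sub_mul_volume_le (hf : ConvexOn ℝ D f) (hg : ConvexOn ℝ D g) (hK : IsConvexBody K)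
    (hKG : ∀ y, y ∈ K ↔ y ∈ D ∧ g y ≤ G) (h₀ : 0 ∈ K)
    (hint : IntegrableOn (fun y => (f y - g y) ^ 2) (frontier K) μHE[n]) (hx : x ∈ D)
    (hxK : x ∉ K) (hgap : f x ≤ G) {a c : ℝ} (ha : 0 < a) (hc : c < 1) :
    (a * (G - f x)) ^ 2 * volume.real (depth (F.coordSet K) ⁻¹' Icc a c) ≤
      2 * ((1 - c)⁻¹ ^ (n + 1) + 1) * ∫ y in frontier K, (f y - g y) ^ 2 ∂μHE[n] := by
  have hC := isCompact_coordSet (F := F) hK.isCompact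
  set A := depth (F.coordSet K) ⁻¹' Icc a c
  have hA : MeasurableSet A :=
    measurable_depth hC (convex_coordSet hK.convex) (zero_mem_coordSet h₀) measurableSet_Icc
  have hAK : A ⊆ Prod.fst '' F.coordSet K := fun z hz =>
    mem_fst_image_of_depth_pos (ha.trans_le hz.1)
  have hA_top : volume A ≠ ∞ :=
    measure_ne_top_of_subset hAK (hC.image continuous_fst).measure_ne_top
  obtain ⟨hint_sum, integral_sum_le⟩ := integral_exitPoint_add_lowerPoint_le hK h₀ hxK hA hAK hc
    (fun z hz => hz.2) hint fun y => sq_nonneg _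
  rw [mul_assoc]
  refine le_trans ?_ (mul_le_mul_of_nonneg_left integral_sum_le two_pos.le)
  rw [mul_comm, ← smul_eq_mul, ← setIntegral_const, ← integral_const_mul]
  refine setIntegral_mono_on (integrableOn_const hA_top) (hint_sum.const_mul 2) hA fun z hz => ?_
  refine le_trans ?_ (sq_depth_mul_sub_le hf hg hK hKG hx hxK hgap (hAK hz))
  gcongr
  exact hz.1

end AxialFrame

theorem inv_one_sub_pow_le_two {N : ℕ} (hN : 1 ≤ N) : (1 - 1 / (2 * (N : ℝ)))⁻¹ ^ N ≤ 2 := by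
  have hN' : (1 : ℝ) ≤ N := by exact_mod_cast hN
  have hbernoulli := one_add_mul_le_pow (a := -(1 / (2 * (N : ℝ)))) (by
    rw [neg_le_neg_iff, div_le_iff₀ (by positivity)]; linarith) N
  rw [mul_neg, mul_one_div, div_mul_cancel_right₀ (by positivity), ← sub_eq_add_neg,
    ← sub_eq_add_neg] at hbernoulli
  rw [inv_pow]
  exact inv_le_of_inv_le₀ two_pos (by linarith)

theorem sq_mul_shadow_le (hf : ConvexOn ℝ D f) (hg : ConvexOn ℝ D g) (hK : IsConvexBody K)
    (hKG : ∀ y, y ∈ K ↔ y ∈ D ∧ g y ≤ G) (h₀ : 0 ∈ K)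
    (hint : IntegrableOn (fun y => (f y - g y) ^ 2) (frontier K) μHE[n]) (hx : x ∈ D)
    (hx₀ : x ≠ 0) (hxK : x ∉ K) (hgap : f x ≤ G) (hpos : 0 < avgDepthRatio K x)
    (hle : avgDepthRatio K x ≤ 1 / (32 * ((n + 1 : ℕ) : ℝ))) :
    (avgDepthRatio K x * (G - f x)) ^ 2 *
        (μHE[n] : Measure (EuclideanSpace ℝ (Fin (n + 1)))).real (shadow x K) ≤
      1536 * ∫ y in frontier K, (f y - g y) ^ 2 ∂μHE[n] := by
  obtain ⟨F⟩ := nonempty_axialFrame hx₀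
  rw [AxialFrame.euclideanHausdorffMeasure_real_shadow (F := F)]
  set c : ℝ := 1 / (2 * ((n + 1 : ℕ) : ℝ)) with hc_def
  have hc : c < 1 := by
    rw [hc_def, div_lt_one (by positivity)]
    push_cast
    linarith [n.cast_nonneg (α := ℝ)]
  have hmean_c : 16 * avgDepthRatio K x ≤ c := by
    have hc_eq : c = 16 * (1 / (32 * ((n + 1 : ℕ) : ℝ))) := by
      rw [hc_def]
      ring
    exact hc_eq ▸ mul_le_mul_of_nonneg_left hle (by norm_num)
  have hband := (IsMidpointPrekopaLeindler.volume_euclideanSpace n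
    ).measureReal_div_sixteen_le_depth_preimage_Icc
      (AxialFrame.isCompact_coordSet (F := F) hK.isCompact) (AxialFrame.convex_coordSet hK.convex)
      (AxialFrame.zero_mem_coordSet h₀) (AxialFrame.zero_one_mem_coordSet_iff.not.mpr hxK)
      (AxialFrame.volume_real_fst_image_coordSet_pos hK) hpos (AxialFrame.setIntegral_depth hK h₀)
      hmean_c
  have hgap_band := AxialFrame.sq_mul_sub_mul_volume_le (F := F) hf hg hK hKG h₀ hint hx hxK hgap
    (div_pos hpos four_pos) hc
  have hintegral : 0 ≤ ∫ y in frontier K, (f y - g y) ^ 2 ∂μHE[n] :=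
    integral_nonneg fun y => sq_nonneg _
  have hloss : 2 * ((1 - c)⁻¹ ^ (n + 1) + 1) ≤ 6 := by
    have hpow : (1 - c)⁻¹ ^ (n + 1) ≤ 2 := inv_one_sub_pow_le_two n.succ_pos
    linarith
  have hband_sq := mul_le_mul_of_nonneg_left hband
    (sq_nonneg (avgDepthRatio K x / 4 * (G - f x)))
  have hsix := mul_le_mul_of_nonneg_right hloss hintegral
  linarith

theorem avgDepthRatio_mul_sub_le (hf : ConvexOn ℝ D f) (hg : ConvexOn ℝ D g) (hK : IsConvexBody K)
    (hKG : ∀ y, y ∈ K ↔ y ∈ D ∧ g y ≤ G) (h₀ : 0 ∈ K)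
    (hint : Integrable (fun y => (f y - g y) ^ 2) (surfaceProb K)) (hx : x ∈ D)
    (hpos : 0 < avgDepthRatio K x) (hle : avgDepthRatio K x ≤ 1 / (32 * ((n + 1 : ℕ) : ℝ))) :
    avgDepthRatio K x * (G - f x) ≤
      40 * √(maxSurfaceShadowRatio K * ∫ y, (f y - g y) ^ 2 ∂surfaceProb K) := by
  rcases le_total G (f x) with hgap | hgap
  · exact (mul_nonpos_of_nonneg_of_nonpos hpos.le (sub_nonpos.mpr hgap)).trans (by positivity)
  have hx₀ : x ≠ 0 := by
    rintro rfl
    exact hpos.ne' (avgDepthRatio_zero hK.interior_nonempty)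
  have hxK : x ∉ K := by
    intro hxK
    rw [avgDepthRatio_of_mem hK h₀ hx₀ hxK, le_div_iff₀ (by positivity)] at hle
    push_cast at hle
    linarith [n.cast_nonneg (α := ℝ)]
  have hshadow : 0 < (μHE[n] : Measure (EuclideanSpace ℝ (Fin (n + 1)))).real (shadow x K) := by
    obtain ⟨F⟩ := nonempty_axialFrame hx₀
    rw [AxialFrame.euclideanHausdorffMeasure_real_shadow (F := F)]
    exact AxialFrame.volume_real_fst_image_coordSet_pos hK
  have hsq := sq_mul_shadow_le hf hg hK hKG h₀ ((integrable_surfaceProb_iff hK).mp hint) hx hx₀ hxK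
    hgap hpos hle
  rw [setIntegral_frontier hK, ← le_div_iff₀ hshadow, mul_div_assoc, mul_div_right_comm] at hsq
  have hintegral : 0 ≤ ∫ y, (f y - g y) ^ 2 ∂surfaceProb K := integral_nonneg fun y => sq_nonneg _
  have hmax := mul_le_mul_of_nonneg_right (surface_div_shadow_le_max hK hx₀) hintegral
  rw [← Real.sqrt_sq (by norm_num : (0 : ℝ) ≤ 40), ← Real.sqrt_mul (sq_nonneg 40)]
  exact Real.le_sqrt_of_sq_le (by nlinarith [sq_nonneg (avgDepthRatio K x * (G - f x))])

theorem integral_surfaceProb_le (hK : IsConvexBody K) (hg : Integrable g (surfaceProb K))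
    (hG : ∀ y ∈ K, g y ≤ G) : ∫ y, g y ∂surfaceProb K ≤ G := by
  have := isProbabilityMeasure_surfaceProb hK
  have hae : g ≤ᵐ[surfaceProb K] fun _ => G :=
    (ae_surfaceProb_mem hK.isCompact.isClosed).mono hG
  simpa using integral_mono_ae hg (integrable_const G) hae

end Gap

end ConvexBandit

open ConvexBandit in
theorem mainTheorem3_general {d : ℕ} (hd : 1 ≤ d) {D K : Set (EuclideanSpace ℝ (Fin d))}
    {f g : EuclideanSpace ℝ (Fin d) → ℝ} (hf : ConvexOn ℝ D f) (hg : ConvexOn ℝ D g) {G : ℝ}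
    (hK : IsConvexBody K) (hKG : ∀ y, y ∈ K ↔ y ∈ D ∧ g y ≤ G)
    (hgint : Integrable g (surfaceProb K))
    (hfgint : Integrable (fun y => (f y - g y) ^ 2) (surfaceProb K))
    {x : EuclideanSpace ℝ (Fin d)} (hx : x ∈ D) (h₀ : 0 ∈ K)
    (hΨ : avgDepthRatio K x ∈ Set.Icc (1 / (128 * (d : ℝ))) (1 / (32 * (d : ℝ)))) :
    ∫ y, g y ∂surfaceProb K - f x ≤
      2 ^ 13 * (d : ℝ) *
        √(maxSurfaceShadowRatio K * ∫ y, (f y - g y) ^ 2 ∂surfaceProb K) := by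
  obtain ⟨n, rfl⟩ := Nat.exists_eq_succ_of_ne_zero (Nat.one_le_iff_ne_zero.mp hd)
  have hpos : 0 < avgDepthRatio K x := lt_of_lt_of_le (by positivity) hΨ.1
  have hmean : ∫ y, g y ∂surfaceProb K ≤ G :=
    integral_surfaceProb_le hK hgint fun y hy => ((hKG y).mp hy).2
  have hgap := avgDepthRatio_mul_sub_le hf hg hK hKG h₀ hfgint hx hpos hΨ.2
  have hdepth := (div_le_iff₀ (by positivity)).mp hΨ.1
  set r := √(maxSurfaceShadowRatio K * ∫ y, (f y - g y) ^ 2 ∂surfaceProb K)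
  have hr : 0 ≤ r := Real.sqrt_nonneg _
  calc ∫ y, g y ∂surfaceProb K - f x ≤ max (G - f x) 0 :=
        (sub_le_sub_right hmean _).trans (le_max_left _ _)
    _ ≤ 2 ^ 13 * ((n + 1 : ℕ) : ℝ) * r := by
        have hright : 0 ≤ 2 ^ 13 * ((n + 1 : ℕ) : ℝ) * r := mul_nonneg (by positivity) hr
        refine max_le ?_ hright
        rcases le_total (G - f x) 0 with hneg | hnonneg
        · exact hneg.trans hright
        · nlinarith [mul_le_mul_of_nonneg_right hdepth hnonneg]

theorem mainTheorem3 {d : ℕ} (hd : 1 ≤ d)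
    (D : Set (EuclideanSpace ℝ (Fin d))) (hD : ConvexBandit.IsConvexBody D)
    (f g : EuclideanSpace ℝ (Fin d) → ℝ) (hf : ConvexOn ℝ D f) (hg : ConvexOn ℝ D g)
    (hfg : ConvexBandit.infOn D f ≤ ConvexBandit.infOn D g)
    (ε : ℝ) (hε : 0 < ε)
    (K : Set (EuclideanSpace ℝ (Fin d))) (hK : K = ConvexBandit.levelSet D g ε)
    (hKclosed : IsClosed K)
    (hgint : Integrable g (ConvexBandit.surfaceProb K))
    (hfgint : Integrable (fun x => (f x - g x) ^ 2) (ConvexBandit.surfaceProb K))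
    (xs : EuclideanSpace ℝ (Fin d)) (hxs : xs ∈ D) (hmin : IsMinOn f D xs)
    (h0 : (0 : EuclideanSpace ℝ (Fin d)) ∈ K)
    (hΨ : ConvexBandit.avgDepthRatio K xs ∈
      Set.Icc (1 / (128 * (d : ℝ))) (1 / (32 * (d : ℝ)))) :
    (∫ x, g x ∂(ConvexBandit.surfaceProb K)) - ConvexBandit.infOn D f ≤
      2 ^ 13 * (d : ℝ) *
        √(ConvexBandit.maxSurfaceShadowRatio K *
          (∫ x, (f x - g x) ^ 2 ∂(ConvexBandit.surfaceProb K))) := by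
  obtain ⟨n, rfl⟩ : ∃ n, d = n + 1 := ⟨d - 1, by omega⟩
  rw [ConvexBandit.infOn_eq_of_isMinOn hxs hmin]
  refine mainTheorem3_general hd hf hg ?_ (Set.ext_iff.mp hK) hgint hfgint hxs h0 hΨ
  exact hK ▸ ConvexBandit.isConvexBody_levelSet hD hg hε (hK ▸ hKclosed)
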